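/- Let $N\ge 1$ and let $\widehat{\mathcal O}$ be the algebra of power series in $b^1,\dots,b^N$ over $\mathbb C$ that converge near the origin, with partial derivatives $\partial_i$. Let $\widehat D$ be the vertex algebra of chiral differential operators over $\widehat{\mathcal O}$: its space of states is the polynomial algebra $\widehat{\mathcal O}[\,b^i_{-n},a^i_{-n} : n\ge 1,\ 1\le i\le N\,]$ with vacuum $\mathbf 1=1$, where $f\in\widehat{\mathcal O}$ is the state of the field $f(b(z))$, $b^i_{-n}$ is the state of $\frac1{n!}\partial_z^{n}b^i(z)$ and $a^i_{-n}$ that of $\frac1{(n-1)!}\partial_z^{n-1}a^i(z)$; the field of a monomial is the normally ordered product of the fields of its factors (with $f(b(z))$ expanded by the Taylor formula about $b_0$), and $a^i(z)b^j(w)\sim\delta_{ij}/(z-w)$, the other OPE of generators being trivial. Summation over repeated indices is understood, and products of fields at one point are normally ordered. Put $L(z)=a^i(z)\,b^i(z)'$, the field of the state $a^i_{-1}b^i_{-1}\mathbf 1$. Let $g=(g^1,\dots,g^N)\in\widehat{\mathcal O}^N$ be such that the Jacobian matrix $\partial g=(\partial_i g^j)$ is invertible over $\widehat{\mathcal O}$.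 Put $$\phi=\big((\partial g)^{-1}\big)^{t},\qquad \psi^{ij}=\partial_r\phi^{pi}\,\partial_p\phi^{rj},\qquad h=\tfrac12(\phi^{t})^{-1}\psi,$$ $$\tilde b^i(z)=g^i(b)(z),\qquad \tilde a^i(z)=a^j\phi^{ji}(z)+b^k(z)'h^{ki}(z).$$ Let $\operatorname{Tr}\log\partial g\in\widehat{\mathcal O}$ denote any $\lambda$ with $e^{\lambda}=\det\partial g$ near the origin. Such $\lambda$ exist, and $\operatorname{Tr}\ell$ is one of them for every matrix $\ell$ over $\widehat{\mathcal O}$ with $e^{\ell}=\partial g$ near the origin. Then, for every such $\lambda$, the transformed field $L(z)^{\sim}=\tilde a^i(z)\,\tilde b^i(z)'$, i.e. the field of the state $\sum_i\tilde a^i_{(-1)}T\tilde b^i$ (with $T$ the translation operator of $\widehat D$ and $\tilde a^i,\tilde b^i$ also denoting the states of these fields), satisfies $$L(z)^{\sim}=L(z)-\tfrac12\big(\operatorname{Tr}\log\partial g(b(z))\big)''.$$ In particular, if $\tilde g$ is an automorphism of the vertex algebra $\widehat D$ with $b^i(z)\mapsto\tilde b^i(z)$ and $a^i(z)\mapsto\tilde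 a^i(z)$ for all $i$, then $\tilde g$ carries $L(z)$ to $L(z)-\frac12\big(\operatorname{Tr}\log\partial g(b(z))\big)''$. -/

import Mathlib

open Topology

namespace ChiralDiffOp

noncomputable section

/-! ## Convergent power series in `N` variables -/

/-- Absolute convergence on some polydisc around the origin. -/
def IsConvergent {N : ℕ} (f : MvPowerSeries (Fin N) ℂ) : Prop :=
  ∃ r : ℝ, 0 < r ∧ Summable fun m : Fin N →₀ ℕ => ‖MvPowerSeries.coeff m f‖ * r ^ m.degree

theorem IsConvergent.mono_radius {N : ℕ} {f : MvPowerSeries (Fin N) ℂ} {r s : ℝ}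
    (hr : Summable fun m : Fin N →₀ ℕ => ‖MvPowerSeries.coeff m f‖ * r ^ m.degree)
    (hs : 0 < s) (hsr : s ≤ r) :
    Summable fun m : Fin N →₀ ℕ => ‖MvPowerSeries.coeff m f‖ * s ^ m.degree := by
  refine Summable.of_nonneg_of_le (fun m => by positivity) (fun m => ?_) hr
  gcongr

theorem isConvergent_of_finite {N : ℕ} {f : MvPowerSeries (Fin N) ℂ}
    (hf : {m | MvPowerSeries.coeff m f ≠ 0}.Finite) : IsConvergent f := by
  refine ⟨1, one_pos, summable_of_hasFiniteSupport (hf.subset fun m hm => ?_)⟩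
  intro h
  exact hm (by simp [h])

theorem isConvergent_C {N : ℕ} (c : ℂ) :
    IsConvergent (algebraMap ℂ (MvPowerSeries (Fin N) ℂ) c) := by
  classical
  refine isConvergent_of_finite ((Set.finite_singleton 0).subset fun m hm => ?_)
  by_contra h
  apply hm
  rw [MvPowerSeries.algebraMap_apply, MvPowerSeries.coeff_C]
  simp only [Set.mem_singleton_iff] at h
  simp [h]

theorem isConvergent_X {N : ℕ} (i : Fin N) :
    IsConvergent (MvPowerSeries.X i : MvPowerSeries (Fin N) ℂ) := by
  classical
  refine isConvergent_of_finite
    ((Set.finite_singleton (Finsupp.single i 1)).subset fun m hm => ?_)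
  by_contra h
  apply hm
  rw [MvPowerSeries.coeff_X]
  simp only [Set.mem_singleton_iff] at h
  simp [h]

theorem IsConvergent.add {N : ℕ} {f g : MvPowerSeries (Fin N) ℂ}
    (hf : IsConvergent f) (hg : IsConvergent g) : IsConvergent (f + g) := by
  obtain ⟨r, hr, hf⟩ := hf
  obtain ⟨s, hs, hg⟩ := hg
  have hm : 0 < min r s := lt_min hr hs
  refine ⟨min r s, hm, Summable.of_nonneg_of_le (fun m => by positivity) (fun m => ?_)
    ((IsConvergent.mono_radius hf hm (min_le_left _ _)).add
      (IsConvergent.mono_radius hg hm (min_le_right _ _)))⟩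
  rw [map_add, ← add_mul]
  gcongr
  exact norm_add_le _ _

theorem IsConvergent.mul {N : ℕ} {f g : MvPowerSeries (Fin N) ℂ}
    (hf : IsConvergent f) (hg : IsConvergent g) : IsConvergent (f * g) := by
  classical
  obtain ⟨r, hr, hf⟩ := hf
  obtain ⟨s, hs, hg⟩ := hg
  have hm : 0 < min r s := lt_min hr hs
  have hf' := IsConvergent.mono_radius hf hm (min_le_left _ _)
  have hg' := IsConvergent.mono_radius hg hm (min_le_right _ _)
  have hp := hf'.mul_of_nonneg hg' (fun m => by positivity) (fun m => by positivity)
  have h := summable_sum_mul_antidiagonal_of_summable_mul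
    (f := fun m : Fin N →₀ ℕ => ‖MvPowerSeries.coeff m f‖ * min r s ^ m.degree)
    (g := fun m : Fin N →₀ ℕ => ‖MvPowerSeries.coeff m g‖ * min r s ^ m.degree) hp
  refine ⟨min r s, hm, Summable.of_nonneg_of_le (fun m => by positivity) (fun m => ?_) h⟩
  rw [MvPowerSeries.coeff_mul]
  have h1 : ‖∑ p ∈ Finset.HasAntidiagonal.antidiagonal m, MvPowerSeries.coeff p.1 f *
      MvPowerSeries.coeff p.2 g‖ ≤ ∑ p ∈ Finset.HasAntidiagonal.antidiagonal m,
        ‖MvPowerSeries.coeff p.1 f‖ * ‖MvPowerSeries.coeff p.2 g‖ :=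
    (norm_sum_le _ _).trans (le_of_eq (Finset.sum_congr rfl fun p _ => norm_mul _ _))
  refine (mul_le_mul_of_nonneg_right h1 (by positivity)).trans (le_of_eq ?_)
  rw [Finset.sum_mul]
  refine Finset.sum_congr rfl fun p hp => ?_
  rw [← Finset.HasAntidiagonal.mem_antidiagonal.1 hp, map_add, pow_add]
  ring

theorem IsConvergent.pderiv {N : ℕ} {f : MvPowerSeries (Fin N) ℂ}
    (hf : IsConvergent f) (i : Fin N) : IsConvergent (MvPowerSeries.pderiv ℂ i f) := by
  obtain ⟨r, hr, hf⟩ := hf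
  have hinj : Function.Injective fun m : Fin N →₀ ℕ => m + Finsupp.single i 1 :=
    add_left_injective _
  have h := (hf.comp_injective hinj).mul_left r⁻¹
  refine ⟨r / 2, by positivity, Summable.of_nonneg_of_le (fun m => by positivity)
    (fun m => ?_) h⟩
  have hmi : (m i : ℝ) + 1 ≤ 2 ^ m.degree := by
    have h1 : m i ≤ m.degree := Finsupp.le_degree i m
    have h2 : m.degree < 2 ^ m.degree := Nat.lt_two_pow_self
    exact_mod_cast (by omega : m i + 1 ≤ 2 ^ m.degree)
  have hn : ‖((m i : ℂ) + 1)‖ = (m i : ℝ) + 1 := by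
    exact_mod_cast Complex.norm_natCast (m i + 1)
  rw [MvPowerSeries.coeff_pderiv, norm_mul, hn]
  simp only [Function.comp_apply, map_add, Finsupp.degree_single, pow_add, pow_one]
  rw [div_pow]
  have : 0 < (2 : ℝ) ^ m.degree := by positivity
  calc _ = ‖MvPowerSeries.coeff (m + Finsupp.single i 1) f‖ * r ^ m.degree *
        (((m i : ℝ) + 1) / 2 ^ m.degree) := by ring
    _ ≤ ‖MvPowerSeries.coeff (m + Finsupp.single i 1) f‖ * r ^ m.degree * 1 := by
        gcongr
        rwa [div_le_one this]
    _ = _ := by field_simp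

/-- The algebra of power series in `b¹, …, b^N` that converge in a neighbourhood of the
origin. -/
def ConvSeries (N : ℕ) : Subalgebra ℂ (MvPowerSeries (Fin N) ℂ) where
  carrier := {f | IsConvergent f}
  mul_mem' := IsConvergent.mul
  add_mem' := IsConvergent.add
  algebraMap_mem' := isConvergent_C

/-- The coordinate `bⁱ`. -/
def coord {N : ℕ} (i : Fin N) : ConvSeries N := ⟨MvPowerSeries.X i, isConvergent_X i⟩

/-- The partial derivative `∂ᵢ = ∂/∂bⁱ` of convergent power series. -/
def del {N : ℕ} (i : Fin N) : ConvSeries N →ₗ[ℂ] ConvSeries N where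
  toFun f := ⟨MvPowerSeries.pderiv ℂ i f.1, IsConvergent.pderiv f.2 i⟩
  map_add' f g := Subtype.ext (map_add (MvPowerSeries.pderiv ℂ i) f.1 g.1)
  map_smul' c f := Subtype.ext ((MvPowerSeries.pderiv ℂ i).map_smul c f.1)

/-- The value at `z` of the holomorphic germ defined by `f` (meaningful for `z` close to `0`). -/
def evalAt {N : ℕ} (f : ConvSeries N) (z : Fin N → ℂ) : ℂ :=
  ∑' m : Fin N →₀ ℕ, MvPowerSeries.coeff m f.1 * m.prod fun i k => z i ^ k

/-- `lam` is a branch of `log u`, as a germ at the origin. -/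
def IsLog {N : ℕ} (lam u : ConvSeries N) : Prop :=
  ∀ᶠ z in 𝓝 (0 : Fin N → ℂ), Complex.exp (evalAt lam z) = evalAt u z

/-- The matrix germ `ℓ` is a branch of the matrix logarithm `log A`. -/
def IsMatrixLog {N : ℕ} (ℓ A : Matrix (Fin N) (Fin N) (ConvSeries N)) : Prop :=
  ∀ᶠ z in 𝓝 (0 : Fin N → ℂ),
    NormedSpace.exp (ℓ.map fun f => evalAt f z) = A.map fun f => evalAt f z

/-! ## The vertex algebra of chiral differential operators

Its space of states is the polynomial algebra over the convergent power series in `b₀` on the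
creation operators `bⁱ₋ₙ` and `aⁱ₋ₙ`, `n ≥ 1`. -/

/-- The creation operators: `b i n` is `bⁱ_{-n-1}` and `a i n` is `aⁱ_{-n-1}`. -/
inductive Creation (N : ℕ) : Type
  | b (i : Fin N) (n : ℕ)
  | a (i : Fin N) (n : ℕ)

/-- The space of states. The vacuum vector is `1`. -/
abbrev CDO (N : ℕ) : Type := MvPolynomial (Creation N) (ConvSeries N)

/-- The state `f(b₀)𝟏`. -/
def ofSeries {N : ℕ} (f : ConvSeries N) : CDO N := MvPolynomial.C f

/-- The generating state `bⁱ₀𝟏`. -/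
def stateB {N : ℕ} (i : Fin N) : CDO N := ofSeries (coord i)

/-- The generating state `aⁱ₋₁𝟏`. -/
def stateA {N : ℕ} (i : Fin N) : CDO N := MvPolynomial.X (Creation.a i 0)

/-- `∂/∂bⁱ₀`: differentiation of the coefficients of a state. -/
def delCoeff {N : ℕ} (i : Fin N) (u : CDO N) : CDO N :=
  ∑ m ∈ u.support, MvPolynomial.monomial m (del i (u.coeff m))

/-- The canonical derivation `T = L₋₁`:
`T bⁱ₋ₙ = (n+1) bⁱ₋ₙ₋₁` for `n ≥ 0` and `T aⁱ₋ₙ = n aⁱ₋ₙ₋₁` for `n ≥ 1`. -/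
def translation {N : ℕ} (u : CDO N) : CDO N :=
  ∑ i : Fin N, delCoeff i u * MvPolynomial.X (Creation.b i 0) +
  MvPolynomial.mkDerivation (ConvSeries N) (A := CDO N)
    (fun x : Creation N => match x with
      | Creation.b i n => ((n : ℂ) + 2) • MvPolynomial.X (Creation.b i (n + 1))
      | Creation.a i n => ((n : ℂ) + 1) • MvPolynomial.X (Creation.a i (n + 1))) u

/-- `Tᵏ / k!`. -/
def dividedTranslation {N : ℕ} (k : ℕ) (u : CDO N) : CDO N :=
  ((k.factorial : ℂ)⁻¹) • translation^[k] u

/-- The states `T⁽ⁿ⁾bⁱ` and `T⁽ⁿ⁾aⁱ` (`n ≥ 0`), where `T⁽ⁿ⁾ = Tⁿ/n!`: `b i n` stands for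
`bⁱ_{-n}𝟏` and `a i n` for `aⁱ_{-n-1}𝟏`. Thus `b i 0` stands for `bⁱ₀` and all the others are the
creation operators. -/
inductive Gen (N : ℕ) : Type
  | b (i : Fin N) (n : ℕ)
  | a (i : Fin N) (n : ℕ)

/-- A creation operator as an element of `Gen`. -/
def Creation.toGen {N : ℕ} : Creation N → Gen N
  | Creation.b i n => Gen.b i (n + 1)
  | Creation.a i n => Gen.a i n

/-- The partial derivative of a state with respect to an element of `Gen`. -/
def delGen {N : ℕ} : Gen N → CDO N → CDO N
  | Gen.b i 0, u => delCoeff i u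
  | Gen.b i (n + 1), u => MvPolynomial.pderiv (Creation.b i n) u
  | Gen.a i n, u => MvPolynomial.pderiv (Creation.a i n) u

/-- The singular part of the OPE `x(z) y(0)` for `x`, `y` in `Gen`, as a polynomial in `z⁻¹`.
It is obtained from `aⁱ(z) bʲ(w) ∼ δᵢⱼ / (z - w)` and `bʲ(z) aⁱ(w) ∼ -δᵢⱼ / (z - w)` by applying
the divided powers of `∂_z` and `∂_w` and setting `w = 0`. -/
def contraction {N : ℕ} : Gen N → Gen N → Polynomial (CDO N)
  | Gen.a i m, Gen.b j n =>
      if i = j then ((-1 : ℂ) ^ m * (m + n).choose m) • Polynomial.X ^ (m + n + 1) else 0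
  | Gen.b i n, Gen.a j m =>
      if i = j then (-(-1 : ℂ) ^ n * (m + n).choose n) • Polynomial.X ^ (m + n + 1) else 0
  | Gen.a _ _, Gen.a _ _ => 0
  | Gen.b _ _, Gen.b _ _ => 0

/-- The annihilation part `x₋(z)` of the free field `x(z)`, applied to a state; the result is a
polynomial in `z⁻¹`. For `x = bⁱ` it is `∑_{k ≥ 1} bⁱₖ z⁻ᵏ` and for `x = aⁱ` it is
`∑_{k ≥ 0} aⁱₖ z⁻ᵏ⁻¹`, where `bⁱₖ = -∂/∂aⁱ₋ₖ` and `aⁱₖ = ∂/∂bⁱ₋ₖ`. In all cases it is the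
derivation whose value at a generator `y` is the singular part of `x(z) y(0)`. -/
def annihilate {N : ℕ} (x : Gen N) (v : CDO N) : Polynomial (CDO N) :=
  ∑ i : Fin N, Polynomial.C (delCoeff i v) * contraction x (Gen.b i 0) +
  MvPolynomial.mkDerivation (ConvSeries N) (A := Polynomial (CDO N))
    (fun y : Creation N => contraction x y.toGen) v

/-- `x₋(z)` extended to polynomials in `z⁻¹` with coefficients in the space of states. -/
def annihilatePoly {N : ℕ} (x : Gen N) (q : Polynomial (CDO N)) : Polynomial (CDO N) :=
  q.sum fun p v => annihilate x v * Polynomial.X ^ p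

/-- The `n`-th product `u₍ₙ₎v` of the vertex algebra, the coefficient at `z⁻ⁿ⁻¹` in `Y(u, z)v`.

A state `u` is a function `u(x₁, x₂, …)` of the elements of `Gen`, and `Y(u, z)` is the normally
ordered expression `:u(x₁(z), x₂(z), …):`, where `x(z) = x₊(z) + x₋(z)`, the creation parts
`x₊(z) = e^{zT}x` act by multiplication and stand to the left of the annihilation parts. By the
Taylor formula
`Y(u, z)v = ∑ₖ (1/k!) ∑_{x₁, …, xₖ} (e^{zT} ∂_{x₁}⋯∂_{xₖ}u) · x₁₋(z)⋯xₖ₋(z)v`,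
in which only finitely many terms are nonzero for given `u` and `v`. For `u = f(b₀)𝟏` this is the
Taylor expansion of `f(b(z))` about `b₀`. -/
def nthProd {N : ℕ} (n : ℤ) (u v : CDO N) : CDO N :=
  ∑ᶠ l : List (Gen N), ((l.length.factorial : ℂ)⁻¹) •
    (l.foldr annihilatePoly (Polynomial.C v)).sum fun p w =>
      if n < p then dividedTranslation ((p : ℤ) - n - 1).toNat (l.foldr delGen u) * w else 0

/-- A formal field `A(z) = ∑ₙ A₍ₙ₎ z⁻ⁿ⁻¹`, given by its modes. -/
abbrev Field (N : ℕ) : Type := ℤ → CDO N → CDO N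

/-- The field `Y(u, z)` of the state `u`. For `f` a convergent series, `field (ofSeries f)` is
`f(b(z))`. -/
def field {N : ℕ} (u : CDO N) : Field N := fun n v => nthProd n u v

/-- The derivative `A(z)'`, whose modes are `-n A₍ₙ₋₁₎`. -/
def fieldDeriv {N : ℕ} (A : Field N) : Field N := fun n v => (-(n : ℂ)) • A (n - 1) v

/-- The state `∑ᵢ αⁱ₍₋₁₎ T βⁱ` of the normally ordered product field `αⁱ(z) βⁱ(z)'`. -/
def virasoroState {N : ℕ} (α β : Fin N → CDO N) : CDO N :=
  ∑ i, nthProd (-1) (α i) (translation (β i))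

/-- The Virasoro vector, whose field is `L(z) = aⁱ(z) bⁱ(z)'`. -/
def virasoro (N : ℕ) : CDO N := virasoroState stateA stateB

/-- Vertex algebra automorphisms. -/
structure IsAutomorphism {N : ℕ} (F : CDO N ≃ₗ[ℂ] CDO N) : Prop where
  map_vacuum : F 1 = 1
  map_nthProd : ∀ (n : ℤ) (u v : CDO N), F (nthProd n u v) = nthProd n (F u) (F v)

/-! ## Coordinate changes -/

/-- The Jacobian matrix `∂g = (∂ᵢ gʲ)`. -/
def jacobian {N : ℕ} (g : Fin N → ConvSeries N) : Matrix (Fin N) (Fin N) (ConvSeries N) :=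
  Matrix.of fun i j => del i (g j)

/-- `φ(g)`, the transpose of the inverse of `∂g`. -/
def phi {N : ℕ} (g : Fin N → ConvSeries N) : Matrix (Fin N) (Fin N) (ConvSeries N) :=
  ((jacobian g)⁻¹).transpose

/-- `ψⁱʲ(g) = ∂ᵣφᵖⁱ ∂ₚφʳʲ`. -/
def psi {N : ℕ} (g : Fin N → ConvSeries N) : Matrix (Fin N) (Fin N) (ConvSeries N) :=
  Matrix.of fun i j => ∑ p, ∑ r, del r (phi g p i) * del p (phi g r j)

/-- `h(g) = ½ (φ(g)ᵗ)⁻¹ ψ(g)`. -/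
def hMatrix {N : ℕ} (g : Fin N → ConvSeries N) : Matrix (Fin N) (Fin N) (ConvSeries N) :=
  (1 / 2 : ℂ) • ((phi g).transpose⁻¹ * psi g)

/-- The transformed generator `gⁱ(b)`. -/
def transB {N : ℕ} (g : Fin N → ConvSeries N) (i : Fin N) : CDO N := ofSeries (g i)

/-- The transformed generator: the state `aʲ₋₁ φʲⁱ + bᵏ₋₁ hᵏⁱ` of the field
`aʲφʲⁱ(z) + bᵏ(z)'hᵏⁱ(z)`. -/
def transA {N : ℕ} (g : Fin N → ConvSeries N) (h : Matrix (Fin N) (Fin N) (ConvSeries N))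
    (i : Fin N) : CDO N :=
  ∑ j, MvPolynomial.X (Creation.a j 0) * ofSeries (phi g j i) +
  ∑ k, MvPolynomial.X (Creation.b k 0) * ofSeries (h k i)

end

end ChiralDiffOp

/-!
The state `∑ᵢ ãⁱ₍₋₁₎ T b̃ⁱ` is computed from Wick's formula, and the resulting equation between states
is transported to fields.

*States.* `ãⁱ` has degree one in the `aʲ₋ₙ`, and `T b̃ⁱ` does not involve them. Hence at most one
contraction occurs, that of `aʲ` with `T gⁱ(b)`, which has a simple and a double pole
(`nthProd_neg_one_X_a_mul_C`). With `J = ∂g`, `φ = (J⁻¹)ᵗ` and `T` acting on functions of `b₀`, this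
gives
`∑ aʲ φʲⁱ T gⁱ + ∑ bᵏ₋₁ hᵏⁱ T gⁱ + ∑ Tφʲⁱ TJʲⁱ + ½ ∑ T²φʲⁱ Jʲⁱ`.
The first sum is `L`, since `J J⁻¹ = 1`. Differentiating `J J⁻¹ = 1` and using that `∂ᵢJʲᵏ` is
symmetric in `i` and `j`, the matrix `h` is found to be such that the second sum is
`-½ ∑ Tφʲⁱ TJʲⁱ` (`sum_hMatrix_mul_jacobian`). Since `∑ φʲⁱ Jʲⁱ` is constant, `T²` kills it, and
what remains besides `L` is `-½ T (∑ φʲⁱ TJʲⁱ)`. By Jacobi's formula `∑ φʲⁱ TJʲⁱ = T λ` for every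
logarithm `λ` of `det J` (`IsLog.del_eq_trace`), so the state is `L - ½ T² λ`.

*Fields.* The sum over lists that defines `Y(u, z)v` is the exponential of the operator
`∑ₓ ∂ₓ ⊗ x₋(z)` on `(states) ⊗ (polynomials in z⁻¹)`, applied to `u ⊗ v` (`nthProd_eq_sum`); it is a
finite sum because each contraction consumes an `a` of `u` or of `v`. This makes `Y` linear in `u`,
and as the operator commutes with `T ⊗ 1 + 1 ⊗ ∂_z`, one has `Y(Tu, z) = ∂_z Y(u, z)`
(`nthProd_translation`).

*Logarithms.* Taking the germ at the origin is an injective ring homomorphism from convergent power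
series to germs of functions, compatible with partial derivatives (`toGerm_injective`,
`hasDerivAt_evalAt`). Thus the analytic relation `e^λ = det J` can be differentiated formally.
Logarithms exist by substitution into the logarithm series (`exists_isLog`), and traces of matrix
logarithms are logarithms because `det (exp A) = exp (tr A)` (`det_exp`).
-/

namespace ChiralDiffOp

open Topology Filter

noncomputable section

/-! ### Derivatives of determinants -/

/-- Jacobi's formula in combinatorial form: the product rule applied to the Leibniz expansion of
`det M` gives `tr (adj(M) N)`, where `N` stands for the derivative of `M`. -/
theorem sum_perm_erase_eq_trace_adjugate_mul {n R : Type*} [Fintype n] [DecidableEq n]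
    [CommRing R] (M N : Matrix n n R) :
    ∑ σ : Equiv.Perm n, Equiv.Perm.sign σ •
      ∑ i, (∏ j ∈ Finset.univ.erase i, M (σ j) j) * N (σ i) i = (M.adjugate * N).trace := by
  have h (i : n) : (M.adjugate * N) i i = ∑ σ : Equiv.Perm n, Equiv.Perm.sign σ •
      ((∏ j ∈ Finset.univ.erase i, M (σ j) j) * N (σ i) i) := by
    have h1 : (M.adjugate * N) i i = (M.updateCol i fun k => N k i).det := by
      rw [← Matrix.cramer_apply, Matrix.cramer_eq_adjugate_mulVec]
      rfl
    rw [h1, Matrix.det_apply]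
    refine Finset.sum_congr rfl fun σ _ => ?_
    rw [← Finset.mul_prod_erase Finset.univ _ (Finset.mem_univ i), mul_comm]
    congr 2
    · refine Finset.prod_congr rfl fun j hj => ?_
      rw [Matrix.updateCol_ne (Finset.ne_of_mem_erase hj)]
    · rw [Matrix.updateCol_self]
  simp only [Matrix.trace, Matrix.diag, h, Finset.smul_sum]
  rw [Finset.sum_comm]

/-- Jacobi's formula for the derivative of the determinant of a curve of matrices. -/
theorem hasDerivAt_det {n : Type*} [Fintype n] [DecidableEq n] {M : ℂ → Matrix n n ℂ}
    {M' : Matrix n n ℂ} {t : ℂ} (h : ∀ i j, HasDerivAt (fun s => M s i j) (M' i j) t) :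
    HasDerivAt (fun s => (M s).det) ((M t).adjugate * M').trace t := by
  rw [← sum_perm_erase_eq_trace_adjugate_mul]
  simp only [Matrix.det_apply]
  refine HasDerivAt.fun_sum fun σ _ => ?_
  have h1 := HasDerivAt.fun_finsetProd (u := Finset.univ) fun i _ => h (σ i) i
  simp only [smul_eq_mul] at h1
  simpa only [Units.smul_def, zsmul_eq_mul] using h1.const_mul _

/-- A product rule for finite products that only presupposes a Leibniz map. -/
theorem leibniz_prod {R ι : Type*} [CommRing R] [DecidableEq ι] (d : R →+ R)
    (hd : ∀ a b, d (a * b) = a * d b + b * d a) (s : Finset ι) (f : ι → R) :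
    d (∏ i ∈ s, f i) = ∑ i ∈ s, (∏ j ∈ s.erase i, f j) * d (f i) := by
  have h1 : d 1 = 0 := by simpa using hd 1 1
  induction s using Finset.induction_on with
  | empty => simp [h1]
  | insert a s ha ih =>
    rw [Finset.prod_insert ha, hd, ih, Finset.sum_insert ha, Finset.erase_insert ha, add_comm,
      Finset.mul_sum]
    congr 1
    refine Finset.sum_congr rfl fun i hi => ?_
    have hne : a ≠ i := fun h => ha (h ▸ hi)
    rw [Finset.erase_insert_of_ne hne, Finset.prod_insert (fun h => ha (Finset.mem_of_mem_erase h)),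
      mul_assoc]

/-- Jacobi's formula for a Leibniz map on a commutative ring. -/
theorem leibniz_det {n R : Type*} [Fintype n] [DecidableEq n] [CommRing R] (d : R →+ R)
    (hd : ∀ a b, d (a * b) = a * d b + b * d a) (M : Matrix n n R) :
    d M.det = (M.adjugate * M.map d).trace := by
  rw [← sum_perm_erase_eq_trace_adjugate_mul, Matrix.det_apply, map_sum]
  refine Finset.sum_congr rfl fun σ _ => ?_
  rw [Units.smul_def, Units.smul_def, map_zsmul, leibniz_prod d hd]
  rfl

section MatrixExp

open scoped Matrix.Norms.Operator

/-- `det (exp (t A)) = exp (t tr A)`: by Jacobi's formula `det (exp (t A)) exp (-t tr A)` has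
derivative zero. -/
theorem det_exp {n : Type*} [Fintype n] [DecidableEq n] (A : Matrix n n ℂ) :
    (NormedSpace.exp A).det = Complex.exp A.trace := by
  have hE (t : ℂ) : HasDerivAt (fun s : ℂ => (NormedSpace.exp (s • A)).det)
      ((NormedSpace.exp (t • A)).det * A.trace) t := by
    have h1 := hasDerivAt_exp_smul_const (𝕂 := ℂ) A t
    have h2 : ∀ i j, HasDerivAt (fun s : ℂ => NormedSpace.exp (s • A) i j)
        ((NormedSpace.exp (t • A) * A) i j) t := by
      intro i j
      have := hasDerivAt_pi.1 h1 i
      exact hasDerivAt_pi.1 this j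
    have h3 := hasDerivAt_det h2
    rwa [← Matrix.mul_assoc, Matrix.adjugate_mul, Matrix.smul_mul, Matrix.one_mul,
      Matrix.trace_smul, smul_eq_mul] at h3
  have hc (t : ℂ) : HasDerivAt
      (fun s : ℂ => (NormedSpace.exp (s • A)).det * Complex.exp (-(s * A.trace))) 0 t := by
    have h1 : HasDerivAt (fun s : ℂ => Complex.exp (-(s * A.trace)))
        (Complex.exp (-(t * A.trace)) * -A.trace) t := by
      simpa using (((hasDerivAt_id t).mul_const A.trace).neg).cexp
    convert! (hE t).mul h1 using 1
    ring
  have h := is_const_of_deriv_eq_zero (fun t => (hc t).differentiableAt) (fun t => (hc t).deriv) 1 0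
  simp only [one_smul, zero_smul, NormedSpace.exp_zero, Matrix.det_one, one_mul, zero_mul, neg_zero,
    Complex.exp_zero, mul_one] at h
  rw [Complex.exp_neg] at h
  exact mul_inv_eq_one₀ (Complex.exp_ne_zero _) |>.1 h

end MatrixExp

/-! ### Convergent power series as germs of functions -/

/-- The value of the monomial with exponent `m` at `z`. -/
def monomialAt {N : ℕ} (z : Fin N → ℂ) (m : Fin N →₀ ℕ) : ℂ := m.prod fun i k => z i ^ k

theorem monomialAt_add {N : ℕ} (z : Fin N → ℂ) (m n : Fin N →₀ ℕ) :
    monomialAt z (m + n) = monomialAt z m * monomialAt z n :=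
  Finsupp.prod_add_index' (fun _ => pow_zero _) fun _ _ _ => pow_add _ _ _

theorem norm_monomialAt_le {N : ℕ} {z : Fin N → ℂ} {r : ℝ} (hz : ∀ i, ‖z i‖ ≤ r)
    (m : Fin N →₀ ℕ) : ‖monomialAt z m‖ ≤ r ^ m.degree := by
  rw [monomialAt, Finsupp.prod, norm_prod, Finsupp.degree_apply, ← Finset.prod_pow_eq_pow_sum]
  refine Finset.prod_le_prod (fun i _ => norm_nonneg _) fun i _ => ?_
  rw [norm_pow]
  exact pow_le_pow_left₀ (norm_nonneg _) (hz i) _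

/-- Absolute convergence of `f` at `z`. -/
def ConvergesAt {N : ℕ} (f : ConvSeries N) (z : Fin N → ℂ) : Prop :=
  Summable fun m : Fin N →₀ ℕ => ‖MvPowerSeries.coeff m f.1 * monomialAt z m‖

theorem convergesAt_of_summable {N : ℕ} {f : ConvSeries N} {z : Fin N → ℂ} {r : ℝ}
    (hz : ∀ i, ‖z i‖ ≤ r)
    (h : Summable fun m : Fin N →₀ ℕ => ‖MvPowerSeries.coeff m f.1‖ * r ^ m.degree) :
    ConvergesAt f z := by
  refine Summable.of_nonneg_of_le (fun m => norm_nonneg _) (fun m => ?_) h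
  rw [norm_mul]
  gcongr
  exact norm_monomialAt_le hz m

theorem eventually_norm_apply_lt {N : ℕ} {r : ℝ} (hr : 0 < r) :
    ∀ᶠ z in 𝓝 (0 : Fin N → ℂ), ∀ i, ‖z i‖ < r := by
  filter_upwards [Metric.ball_mem_nhds (0 : Fin N → ℂ) hr] with z hz i
  exact (norm_le_pi_norm z i).trans_lt (by simpa using hz)

theorem eventually_convergesAt {N : ℕ} (f : ConvSeries N) :
    ∀ᶠ z in 𝓝 (0 : Fin N → ℂ), ConvergesAt f z := by
  obtain ⟨r, hr, h⟩ := f.2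
  filter_upwards [eventually_norm_apply_lt hr] with z hz
  exact convergesAt_of_summable (fun i => (hz i).le) h

theorem evalAt_eq_tsum {N : ℕ} (f : ConvSeries N) (z : Fin N → ℂ) :
    evalAt f z = ∑' m, MvPowerSeries.coeff m f.1 * monomialAt z m := rfl

theorem evalAt_add {N : ℕ} {f g : ConvSeries N} {z : Fin N → ℂ} (hf : ConvergesAt f z)
    (hg : ConvergesAt g z) : evalAt (f + g) z = evalAt f z + evalAt g z := by
  rw [evalAt_eq_tsum, evalAt_eq_tsum, evalAt_eq_tsum, ← hf.of_norm.tsum_add hg.of_norm]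
  refine tsum_congr fun m => ?_
  rw [← add_mul]
  rfl

theorem evalAt_mul {N : ℕ} {f g : ConvSeries N} {z : Fin N → ℂ} (hf : ConvergesAt f z)
    (hg : ConvergesAt g z) : evalAt (f * g) z = evalAt f z * evalAt g z := by
  classical
  have h := Summable.tsum_mul_tsum_eq_tsum_sum_antidiagonal
    (f := fun m => MvPowerSeries.coeff m f.1 * monomialAt z m)
    (g := fun m => MvPowerSeries.coeff m g.1 * monomialAt z m) hf.of_norm hg.of_norm
    (summable_mul_of_summable_norm (f := fun m => MvPowerSeries.coeff m f.1 * monomialAt z m)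
      (g := fun m => MvPowerSeries.coeff m g.1 * monomialAt z m) hf hg)
  rw [evalAt_eq_tsum f, evalAt_eq_tsum g, h]
  refine tsum_congr fun m => ?_
  change MvPowerSeries.coeff m (f.1 * g.1) * monomialAt z m = _
  rw [MvPowerSeries.coeff_mul, Finset.sum_mul]
  refine Finset.sum_congr rfl fun p hp => ?_
  rw [← Finset.HasAntidiagonal.mem_antidiagonal.1 hp, monomialAt_add]
  ring

theorem evalAt_algebraMap {N : ℕ} (c : ℂ) (z : Fin N → ℂ) :
    evalAt (algebraMap ℂ (ConvSeries N) c) z = c := by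
  classical
  rw [evalAt, tsum_eq_single 0]
  · change MvPowerSeries.coeff 0 (MvPowerSeries.C c) * _ = c
    simp
  · intro m hm
    change MvPowerSeries.coeff m (MvPowerSeries.C c) * _ = 0
    simp [MvPowerSeries.coeff_C, hm]

/-- The ring homomorphism from convergent power series to germs of functions at the origin. -/
def toGerm {N : ℕ} : ConvSeries N →+* Germ (𝓝 (0 : Fin N → ℂ)) ℂ where
  toFun f := (evalAt f : (Fin N → ℂ) → ℂ)
  map_one' := by
    refine Germ.coe_eq.2 (Eventually.of_forall fun z => ?_)
    simpa using evalAt_algebraMap (1 : ℂ) z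
  map_zero' := by
    refine Germ.coe_eq.2 (Eventually.of_forall fun z => ?_)
    simpa using evalAt_algebraMap (0 : ℂ) z
  map_mul' f g := by
    refine Germ.coe_eq.2 ?_
    filter_upwards [eventually_convergesAt f, eventually_convergesAt g] with z hf hg
    exact evalAt_mul hf hg
  map_add' f g := by
    refine Germ.coe_eq.2 ?_
    filter_upwards [eventually_convergesAt f, eventually_convergesAt g] with z hf hg
    exact evalAt_add hf hg

theorem eventually_evalAt_det {N : ℕ} (M : Matrix (Fin N) (Fin N) (ConvSeries N)) :
    ∀ᶠ z in 𝓝 (0 : Fin N → ℂ), evalAt M.det z = (M.map fun f => evalAt f z).det := by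
  have h : toGerm M.det =
      Germ.coeRingHom (𝓝 (0 : Fin N → ℂ)) (M.map fun f => evalAt f).det := by
    rw [RingHom.map_det, RingHom.map_det]
    rfl
  refine (Germ.coe_eq.1 h).trans (Eventually.of_forall fun z => ?_)
  exact RingHom.map_det (Pi.evalRingHom (fun _ : Fin N → ℂ => ℂ) z) _

theorem eventually_evalAt_trace {N : ℕ} (M : Matrix (Fin N) (Fin N) (ConvSeries N)) :
    ∀ᶠ z in 𝓝 (0 : Fin N → ℂ), evalAt M.trace z = (M.map fun f => evalAt f z).trace := by
  have h : toGerm M.trace =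
      Germ.coeRingHom (𝓝 (0 : Fin N → ℂ)) (M.map fun f => evalAt f).trace := by
    rw [Matrix.trace, Matrix.trace, map_sum, map_sum]
    rfl
  refine (Germ.coe_eq.1 h).trans (Eventually.of_forall fun z => ?_)
  simp [Matrix.trace]

/-- The trace of a matrix logarithm of `A` is a logarithm of `det A`. -/
theorem IsMatrixLog.isLog_trace {N : ℕ} {ℓ A : Matrix (Fin N) (Fin N) (ConvSeries N)}
    (h : IsMatrixLog ℓ A) : IsLog ℓ.trace A.det := by
  filter_upwards [h, eventually_evalAt_det A, eventually_evalAt_trace ℓ] with z h1 h2 h3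
  rw [h2, h3, ← h1, det_exp]

/-! ### Derivatives of germs -/

theorem coeff_del {N : ℕ} (i : Fin N) (f : ConvSeries N) (m : Fin N →₀ ℕ) :
    MvPowerSeries.coeff m (del i f).1 =
      MvPowerSeries.coeff (m + Finsupp.single i 1) f.1 * (m i + 1) :=
  MvPowerSeries.coeff_pderiv _ _

theorem del_mul {N : ℕ} (i : Fin N) (f g : ConvSeries N) :
    del i (f * g) = f * del i g + g * del i f :=
  Subtype.ext ((MvPowerSeries.pderiv ℂ i).leibniz f.1 g.1)

theorem del_comm {N : ℕ} (i j : Fin N) (f : ConvSeries N) :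
    del i (del j f) = del j (del i f) := by
  refine Subtype.ext (MvPowerSeries.ext fun m => ?_)
  simp only [coeff_del]
  rw [add_right_comm]
  by_cases h : i = j
  · subst h; ring
  · simp [h, Ne.symm h]
    ring

theorem hasDerivAt_monomialAt_update {N : ℕ} (i : Fin N) (z : Fin N → ℂ) (m : Fin N →₀ ℕ)
    (t : ℂ) : HasDerivAt (fun s => monomialAt (Function.update z i s) m)
      (m i * monomialAt (Function.update z i t) (m - Finsupp.single i 1)) t := by
  have h (n : Fin N →₀ ℕ) (s : ℂ) : monomialAt (Function.update z i s) n =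
      s ^ n i * ∏ j ∈ Finset.univ.erase i, z j ^ n j := by
    rw [monomialAt, Finsupp.prod_fintype _ _ fun _ => pow_zero _,
      ← Finset.mul_prod_erase Finset.univ _ (Finset.mem_univ i), Function.update_self]
    congr 1
    refine Finset.prod_congr rfl fun j hj => ?_
    rw [Function.update_of_ne (Finset.ne_of_mem_erase hj)]
  simp only [h]
  have h2 : ∏ j ∈ Finset.univ.erase i, z j ^ (m - Finsupp.single i 1 : Fin N →₀ ℕ) j =
      ∏ j ∈ Finset.univ.erase i, z j ^ m j := by
    refine Finset.prod_congr rfl fun j hj => ?_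
    simp [Finsupp.single_eq_of_ne (Finset.ne_of_mem_erase hj)]
  rw [h2]
  simpa [mul_assoc] using (hasDerivAt_pow (m i) t).mul_const _

theorem hasDerivAt_evalAt {N : ℕ} (f : ConvSeries N) (i : Fin N) :
    ∀ᶠ z in 𝓝 (0 : Fin N → ℂ),
      HasDerivAt (fun t => evalAt f (Function.update z i t)) (evalAt (del i f) z) (z i) := by
  obtain ⟨r, hr, h⟩ := f.2
  obtain ⟨s, hs, h'⟩ := (del i f).2
  have hρ : 0 < min r s := lt_min hr hs
  filter_upwards [eventually_norm_apply_lt hρ] with z hz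
  have hinj : Function.Injective fun m : Fin N →₀ ℕ => m + Finsupp.single i 1 :=
    add_left_injective _
  -- exponents not divisible by `bⁱ` contribute nothing to the derivative
  have hrange {X : Type} [Zero X] (F : (Fin N →₀ ℕ) → X) (hF : ∀ m, m i = 0 → F m = 0) :
      Function.support F ⊆ Set.range fun m : Fin N →₀ ℕ => m + Finsupp.single i 1 := by
    intro m hm
    have hmi : m i ≠ 0 := fun h0 => hm (hF m h0)
    refine ⟨m - Finsupp.single i 1, tsub_add_cancel_of_le ?_⟩
    rw [Finsupp.single_le_iff]
    omega
  have hu : Summable fun m : Fin N →₀ ℕ =>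
      ‖MvPowerSeries.coeff m f.1‖ * (m i * min r s ^ (m - Finsupp.single i 1 : Fin N →₀ ℕ).degree) := by
    refine (hinj.summable_iff fun m hm => ?_).1 ?_
    · by_contra h0
      refine hm (hrange (fun m : Fin N →₀ ℕ => ‖MvPowerSeries.coeff m f.1‖ *
        (m i * min r s ^ (m - Finsupp.single i 1 : Fin N →₀ ℕ).degree)) (fun m h => ?_) h0)
      simp [h]
    · have := IsConvergent.mono_radius h' hρ (min_le_right _ _)
      refine this.congr fun m => ?_
      have hn : ‖((m i : ℂ) + 1)‖ = (m i : ℝ) + 1 := by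
        exact_mod_cast Complex.norm_natCast (m i + 1)
      simp only [Function.comp_apply, coeff_del, norm_mul, hn, add_tsub_cancel_right,
        Finsupp.add_apply, Finsupp.single_eq_same]
      push_cast
      ring
  have hupd (t : ℂ) (ht : t ∈ Metric.ball (0 : ℂ) (min r s)) (j : Fin N) :
      ‖Function.update z i t j‖ ≤ min r s := by
    by_cases hj : j = i
    · subst hj; simpa using (mem_ball_zero_iff.1 ht).le
    · rw [Function.update_of_ne hj]; exact (hz j).le
  have hzi : z i ∈ Metric.ball (0 : ℂ) (min r s) := mem_ball_zero_iff.2 (hz i)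
  have key := hasDerivAt_tsum_of_isPreconnected
    (g := fun (m : Fin N →₀ ℕ) t =>
      MvPowerSeries.coeff m f.1 * monomialAt (Function.update z i t) m)
    (g' := fun (m : Fin N →₀ ℕ) t => MvPowerSeries.coeff m f.1 *
      (m i * monomialAt (Function.update z i t) (m - Finsupp.single i 1)))
    hu Metric.isOpen_ball (convex_ball (0 : ℂ) (min r s)).isPreconnected
    (fun m t _ => (hasDerivAt_monomialAt_update i z m t).const_mul _)
    (fun m t ht => by
      rw [norm_mul, norm_mul, Complex.norm_natCast]
      gcongr
      exact norm_monomialAt_le (hupd t ht) _)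
    hzi
    (by
      rw [Function.update_eq_self]
      exact (convergesAt_of_summable (fun j => (hz j).le)
        (IsConvergent.mono_radius h hρ (min_le_left _ _))).of_norm)
    hzi
  have heq : evalAt (del i f) z = ∑' m : Fin N →₀ ℕ, MvPowerSeries.coeff m f.1 *
      (m i * monomialAt (Function.update z i (z i)) (m - Finsupp.single i 1)) := by
    rw [← hinj.tsum_eq (hrange _ fun m h => by simp [h])]
    refine tsum_congr fun m => ?_
    rw [coeff_del]
    simp only [Function.update_eq_self, add_tsub_cancel_right, Finsupp.add_apply,
      Finsupp.single_eq_same, monomialAt]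
    push_cast
    ring
  rw [heq]
  exact key

/-- An equality of germs may be differentiated along a coordinate. -/
theorem eventually_eventuallyEq_update {N : ℕ} {F G : (Fin N → ℂ) → ℂ}
    (h : ∀ᶠ z in 𝓝 (0 : Fin N → ℂ), F z = G z) (i : Fin N) :
    ∀ᶠ z in 𝓝 (0 : Fin N → ℂ), (fun t => F (Function.update z i t)) =ᶠ[𝓝 (z i)]
      fun t => G (Function.update z i t) := by
  filter_upwards [eventually_eventually_nhds.2 h] with z hz
  have hc : Tendsto (fun t => Function.update z i t) (𝓝 (z i)) (𝓝 z) := by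
    have : ContinuousAt (fun t => Function.update z i t) (z i) :=
      (continuous_const.update i continuous_id).continuousAt
    simpa [ContinuousAt] using this
  exact hc.eventually hz

theorem evalAt_zero {N : ℕ} (f : ConvSeries N) : evalAt f 0 = MvPowerSeries.coeff 0 f.1 := by
  rw [evalAt, tsum_eq_single 0]
  · simp
  · intro m hm
    obtain ⟨i, hi⟩ := Finsupp.ne_iff.1 hm
    rw [Finsupp.prod_fintype _ _ fun _ => pow_zero _, Finset.prod_eq_zero (Finset.mem_univ i),
      mul_zero]
    exact zero_pow hi

/-- The identity theorem: the coefficients of `f` are its iterated derivatives at the origin, up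
to factorials. -/
theorem toGerm_injective {N : ℕ} : Function.Injective (toGerm (N := N)) := by
  rw [injective_iff_map_eq_zero]
  have key (d : ℕ) : ∀ f : ConvSeries N, (∀ᶠ z in 𝓝 (0 : Fin N → ℂ), evalAt f z = 0) →
      ∀ m : Fin N →₀ ℕ, m.degree = d → MvPowerSeries.coeff m f.1 = 0 := by
    induction d with
    | zero =>
      intro f hf m hm
      rw [(Finsupp.degree_eq_zero_iff m).1 hm, ← evalAt_zero]
      exact hf.self_of_nhds
    | succ d ih =>
      intro f hf m hm
      have hm0 : m ≠ 0 := by rintro rfl; simp at hm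
      obtain ⟨i, hi⟩ := Finsupp.ne_iff.1 hm0
      have hle : Finsupp.single i 1 ≤ m := by
        rw [Finsupp.single_le_iff]; simp at hi; omega
      obtain ⟨n, rfl⟩ := exists_add_of_le hle
      rw [map_add, Finsupp.degree_single] at hm
      have hd : ∀ᶠ z in 𝓝 (0 : Fin N → ℂ), evalAt (del i f) z = 0 := by
        filter_upwards [hasDerivAt_evalAt f i, eventually_eventuallyEq_update hf i] with z h1 h2
        exact h1.unique ((hasDerivAt_const (z i) (0 : ℂ)).congr_of_eventuallyEq h2)
      have h3 := ih _ hd n (by omega)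
      rw [coeff_del, mul_eq_zero] at h3
      rw [add_comm]
      refine h3.resolve_right ?_
      exact_mod_cast Nat.succ_ne_zero (n i)
  intro f hf
  have hf' : ∀ᶠ z in 𝓝 (0 : Fin N → ℂ), evalAt f z = 0 := Germ.coe_eq.1 hf
  exact Subtype.ext (MvPowerSeries.ext fun m => key _ f hf' m rfl)

/-- The logarithmic derivative: `u ∂ᵢ(log u) = ∂ᵢu`. -/
theorem IsLog.mul_del {N : ℕ} {lam u : ConvSeries N} (h : IsLog lam u) (i : Fin N) :
    u * del i lam = del i u := by
  refine toGerm_injective ?_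
  rw [map_mul]
  refine Germ.coe_eq.2 ?_
  filter_upwards [h, hasDerivAt_evalAt lam i, hasDerivAt_evalAt u i,
    eventually_eventuallyEq_update h i] with z h0 h1 h2 h3
  have h4 := h1.cexp.unique (h2.congr_of_eventuallyEq h3)
  simp only [Function.update_eq_self, h0] at h4
  exact h4

/-! ### Logarithms of invertible convergent power series -/

/-- Absolute convergence on the closed polydisc of radius `r`. -/
def ConvergesOn {N : ℕ} (f : ConvSeries N) (r : ℝ) : Prop :=
  Summable fun m : Fin N →₀ ℕ => ‖MvPowerSeries.coeff m f.1‖ * r ^ m.degree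

/-- The majorant norm of `f` on the polydisc of radius `r`. -/
def polydiscNorm {N : ℕ} (r : ℝ) (f : ConvSeries N) : ℝ :=
  ∑' m : Fin N →₀ ℕ, ‖MvPowerSeries.coeff m f.1‖ * r ^ m.degree

theorem polydiscNorm_nonneg {N : ℕ} {r : ℝ} (hr : 0 ≤ r) (f : ConvSeries N) :
    0 ≤ polydiscNorm r f :=
  tsum_nonneg fun m => by positivity

theorem norm_coeff_one {N : ℕ} (r : ℝ) (m : Fin N →₀ ℕ) :
    ‖MvPowerSeries.coeff m (1 : ConvSeries N).1‖ * r ^ m.degree = if m = 0 then 1 else 0 := by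
  classical
  change ‖MvPowerSeries.coeff m (1 : MvPowerSeries (Fin N) ℂ)‖ * r ^ m.degree = _
  rw [MvPowerSeries.coeff_one]
  split_ifs with h <;> simp [h]

theorem polydiscNorm_mul_le {N : ℕ} {r : ℝ} (hr : 0 ≤ r) {f g : ConvSeries N}
    (hf : ConvergesOn f r) (hg : ConvergesOn g r) :
    ConvergesOn (f * g) r ∧ polydiscNorm r (f * g) ≤ polydiscNorm r f * polydiscNorm r g := by
  classical
  have hp := hf.mul_of_nonneg hg (fun m => by positivity) (fun m => by positivity)
  have h := summable_sum_mul_antidiagonal_of_summable_mul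
    (f := fun m : Fin N →₀ ℕ => ‖MvPowerSeries.coeff m f.1‖ * r ^ m.degree)
    (g := fun m : Fin N →₀ ℕ => ‖MvPowerSeries.coeff m g.1‖ * r ^ m.degree) hp
  have ht := Summable.tsum_mul_tsum_eq_tsum_sum_antidiagonal
    (f := fun m : Fin N →₀ ℕ => ‖MvPowerSeries.coeff m f.1‖ * r ^ m.degree)
    (g := fun m : Fin N →₀ ℕ => ‖MvPowerSeries.coeff m g.1‖ * r ^ m.degree) hf hg hp
  have hle (m : Fin N →₀ ℕ) : ‖MvPowerSeries.coeff m (f * g).1‖ * r ^ m.degree ≤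
      ∑ p ∈ Finset.HasAntidiagonal.antidiagonal m,
        (‖MvPowerSeries.coeff p.1 f.1‖ * r ^ p.1.degree) *
          (‖MvPowerSeries.coeff p.2 g.1‖ * r ^ p.2.degree) := by
    change ‖MvPowerSeries.coeff m (f.1 * g.1)‖ * r ^ m.degree ≤ _
    rw [MvPowerSeries.coeff_mul]
    have h1 : ‖∑ p ∈ Finset.HasAntidiagonal.antidiagonal m, MvPowerSeries.coeff p.1 f.1 *
        MvPowerSeries.coeff p.2 g.1‖ ≤ ∑ p ∈ Finset.HasAntidiagonal.antidiagonal m,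
          ‖MvPowerSeries.coeff p.1 f.1‖ * ‖MvPowerSeries.coeff p.2 g.1‖ :=
      (norm_sum_le _ _).trans (le_of_eq (Finset.sum_congr rfl fun p _ => norm_mul _ _))
    refine (mul_le_mul_of_nonneg_right h1 (by positivity)).trans (le_of_eq ?_)
    rw [Finset.sum_mul]
    refine Finset.sum_congr rfl fun p hp => ?_
    rw [← Finset.HasAntidiagonal.mem_antidiagonal.1 hp, map_add, pow_add]
    ring
  have hs : ConvergesOn (f * g) r :=
    Summable.of_nonneg_of_le (fun m => by positivity) hle h
  refine ⟨hs, ?_⟩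
  rw [polydiscNorm, polydiscNorm, polydiscNorm, ht]
  exact hs.tsum_le_tsum hle h

theorem polydiscNorm_pow_le {N : ℕ} {r : ℝ} (hr : 0 ≤ r) {f : ConvSeries N}
    (hf : ConvergesOn f r) (k : ℕ) :
    ConvergesOn (f ^ k) r ∧ polydiscNorm r (f ^ k) ≤ polydiscNorm r f ^ k := by
  induction k with
  | zero =>
    simp only [pow_zero, ConvergesOn, polydiscNorm, norm_coeff_one]
    exact ⟨(hasSum_ite_eq (0 : Fin N →₀ ℕ) (1 : ℝ)).summable, by rw [tsum_ite_eq]⟩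
  | succ k ih =>
    rw [pow_succ, pow_succ]
    have h := polydiscNorm_mul_le hr ih.1 hf
    exact ⟨h.1, h.2.trans (mul_le_mul_of_nonneg_right ih.2 (polydiscNorm_nonneg hr f))⟩

/-- A series without constant term is small on small polydiscs. -/
theorem exists_polydiscNorm_lt_one {N : ℕ} {f : ConvSeries N}
    (h0 : MvPowerSeries.coeff 0 f.1 = 0) :
    ∃ r : ℝ, 0 < r ∧ ConvergesOn f r ∧ polydiscNorm r f < 1 := by
  obtain ⟨R, hR, h⟩ := f.2
  set S := polydiscNorm R f with hS
  have hS0 : 0 ≤ S := polydiscNorm_nonneg hR.le f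
  have ht : 0 < (1 + S)⁻¹ := by positivity
  have ht1 : (1 + S)⁻¹ ≤ 1 := inv_le_one_of_one_le₀ (by linarith)
  have hle (m : Fin N →₀ ℕ) : ‖MvPowerSeries.coeff m f.1‖ * ((1 + S)⁻¹ * R) ^ m.degree ≤
      (1 + S)⁻¹ * (‖MvPowerSeries.coeff m f.1‖ * R ^ m.degree) := by
    by_cases hm : m = 0
    · simp [hm, h0]
    · have hd : 1 ≤ m.degree := by
        rw [Nat.one_le_iff_ne_zero]
        exact fun h => hm ((Finsupp.degree_eq_zero_iff m).1 h)
      have h2 : (1 + S)⁻¹ ^ m.degree ≤ (1 + S)⁻¹ := by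
        simpa using pow_le_pow_of_le_one ht.le ht1 hd
      rw [mul_pow]
      calc _ = (1 + S)⁻¹ ^ m.degree * (‖MvPowerSeries.coeff m f.1‖ * R ^ m.degree) := by ring
        _ ≤ _ := by gcongr
  have hs : ConvergesOn f ((1 + S)⁻¹ * R) :=
    Summable.of_nonneg_of_le (fun m => by positivity) hle (h.mul_left _)
  refine ⟨(1 + S)⁻¹ * R, by positivity, hs, ?_⟩
  have h3 : polydiscNorm ((1 + S)⁻¹ * R) f ≤ (1 + S)⁻¹ * S := by
    rw [hS, polydiscNorm, polydiscNorm, ← tsum_mul_left]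
    exact hs.tsum_le_tsum hle (h.mul_left _)
  refine h3.trans_lt ?_
  rw [inv_mul_lt_iff₀ (by linarith)]
  linarith

theorem ConvergesOn.evalAt_pow {N : ℕ} {f : ConvSeries N} {z : Fin N → ℂ} {r : ℝ} (hf : ConvergesOn f r)
    (hr : 0 ≤ r) (hz : ∀ i, ‖z i‖ ≤ r) (k : ℕ) :
    evalAt (f ^ k) z = evalAt f z ^ k := by
  induction k with
  | zero => simpa using evalAt_algebraMap (1 : ℂ) z
  | succ k ih =>
    rw [pow_succ, pow_succ, evalAt_mul (convergesAt_of_summable hz (polydiscNorm_pow_le hr hf k).1)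
      (convergesAt_of_summable hz hf), ih]

theorem norm_evalAt_le {N : ℕ} {f : ConvSeries N} {z : Fin N → ℂ} {r : ℝ}
    (hz : ∀ i, ‖z i‖ ≤ r) (hf : ConvergesOn f r) : ‖evalAt f z‖ ≤ polydiscNorm r f := by
  rw [evalAt_eq_tsum]
  refine tsum_of_norm_bounded hf.hasSum fun m => ?_
  rw [norm_mul]
  gcongr
  exact norm_monomialAt_le hz m

/-- The logarithm series `∑ₖ (-1)ᵏ⁺¹ fᵏ / k` may be substituted into a series without constant
term. -/
theorem exists_isLog_one_add {N : ℕ} {f : ConvSeries N}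
    (h0 : MvPowerSeries.coeff 0 f.1 = 0) : ∃ lam : ConvSeries N, IsLog lam (1 + f) := by
  obtain ⟨r, hr, hf, hlt⟩ := exists_polydiscNorm_lt_one h0
  have hpow := polydiscNorm_pow_le hr.le hf
  have hq0 := polydiscNorm_nonneg hr.le f
  let c (k : ℕ) : ℂ := (-1) ^ (k + 1) / k
  have hc (k : ℕ) : ‖c k‖ ≤ 1 := by
    simp only [c, norm_div, norm_pow, norm_neg, norm_one, one_pow, Complex.norm_natCast]
    rcases Nat.eq_zero_or_pos k with rfl | hk
    · simp
    · rw [div_le_one (by exact_mod_cast hk)]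
      exact_mod_cast hk
  have hG : Summable fun p : ℕ × (Fin N →₀ ℕ) =>
      ‖MvPowerSeries.coeff p.2 (f ^ p.1).1‖ * r ^ p.2.degree := by
    rw [summable_prod_of_nonneg fun p => by positivity]
    exact ⟨fun k => (hpow k).1, Summable.of_nonneg_of_le
      (fun k => polydiscNorm_nonneg hr.le (f ^ k)) (fun k => (hpow k).2)
      (summable_geometric_of_lt_one hq0 hlt)⟩
  have hG' := hG.prod_symm
  have hk (m : Fin N →₀ ℕ) : Summable fun k => ‖c k * MvPowerSeries.coeff m (f ^ k).1‖ := by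
    have h1 := (hG'.prod_factor m).mul_right (r ^ m.degree)⁻¹
    refine Summable.of_nonneg_of_le (fun k => norm_nonneg _) (fun k => ?_) h1
    have : r ^ m.degree ≠ 0 := (pow_pos hr _).ne'
    simp only [Prod.swap_prod_mk]
    rw [mul_assoc, mul_inv_cancel₀ this, mul_one, norm_mul]
    exact mul_le_of_le_one_left (norm_nonneg _) (hc k)
  let F : MvPowerSeries (Fin N) ℂ := fun m => ∑' k, c k * MvPowerSeries.coeff m (f ^ k).1
  have hFc (m : Fin N →₀ ℕ) :
      MvPowerSeries.coeff m F = ∑' k, c k * MvPowerSeries.coeff m (f ^ k).1 := rfl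
  have hF : Summable fun m : Fin N →₀ ℕ => ‖MvPowerSeries.coeff m F‖ * r ^ m.degree := by
    refine Summable.of_nonneg_of_le (fun m => by positivity) (fun m => ?_) hG'.prod
    rw [hFc]
    have h1 : ‖∑' k, c k * MvPowerSeries.coeff m (f ^ k).1‖ * r ^ m.degree ≤
        (∑' k, ‖c k * MvPowerSeries.coeff m (f ^ k).1‖) * r ^ m.degree := by
      gcongr
      exact norm_tsum_le_tsum_norm (hk m)
    refine h1.trans ?_
    rw [← tsum_mul_right]
    refine ((hk m).mul_right _).tsum_le_tsum (fun k => ?_) (hG'.prod_factor m)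
    rw [norm_mul]
    exact mul_le_mul_of_nonneg_right (mul_le_of_le_one_left (norm_nonneg _) (hc k))
      (by positivity)
  refine ⟨⟨F, r, hr, hF⟩, ?_⟩
  filter_upwards [eventually_norm_apply_lt hr] with z hz
  have hz' : ∀ i, ‖z i‖ ≤ r := fun i => (hz i).le
  have hsum : Summable (Function.uncurry fun (k : ℕ) (m : Fin N →₀ ℕ) =>
      c k * MvPowerSeries.coeff m (f ^ k).1 * monomialAt z m) := by
    refine Summable.of_norm_bounded hG fun p => ?_
    simp only [Function.uncurry, norm_mul]
    gcongr
    · exact mul_le_of_le_one_left (norm_nonneg _) (hc _)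
    · exact norm_monomialAt_le hz' _
  have hev : evalAt ⟨F, r, hr, hF⟩ z = Complex.log (1 + evalAt f z) := by
    have hw : ‖evalAt f z‖ < 1 := (norm_evalAt_le hz' hf).trans_lt hlt
    rw [← (Complex.hasSum_taylorSeries_log hw).tsum_eq, evalAt_eq_tsum]
    simp only [hFc, ← tsum_mul_right]
    rw [hsum.tsum_comm]
    refine tsum_congr fun k => ?_
    rw [← hf.evalAt_pow hr.le hz' k, evalAt_eq_tsum, mul_div_right_comm, ← tsum_mul_left]
    exact tsum_congr fun m => mul_assoc _ _ _
  have hne : 1 + evalAt f z ≠ 0 := by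
    intro h
    have h1 : evalAt f z = -1 := by linear_combination h
    have h2 := (norm_evalAt_le hz' hf).trans_lt hlt
    rw [h1] at h2
    simp at h2
  rw [hev, Complex.exp_log hne, evalAt_add, ← map_one (algebraMap ℂ (ConvSeries N)),
    evalAt_algebraMap]
  · have := (polydiscNorm_pow_le hr.le hf 0).1
    rw [pow_zero] at this
    exact convergesAt_of_summable hz' this
  · exact convergesAt_of_summable hz' hf

theorem exists_isLog {N : ℕ} {u : ConvSeries N} (hu : IsUnit u) :
    ∃ lam : ConvSeries N, IsLog lam u := by
  set a : ℂ := MvPowerSeries.constantCoeff u.1 with ha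
  have ha0 : a ≠ 0 := ((hu.map (ConvSeries N).subtype).map MvPowerSeries.constantCoeff).ne_zero
  obtain ⟨lam, hlam⟩ := exists_isLog_one_add (f := a⁻¹ • u - 1) (by
    change MvPowerSeries.constantCoeff (a⁻¹ • u.1 - 1) = 0
    rw [map_sub, MvPowerSeries.smul_eq_C_mul, map_mul, ← ha]
    simp [ha0])
  refine ⟨algebraMap ℂ _ (Complex.log a) + lam, ?_⟩
  have h1 : algebraMap ℂ (ConvSeries N) a * (1 + (a⁻¹ • u - 1)) = u := by
    rw [add_sub_cancel, ← Algebra.smul_def, smul_smul, mul_inv_cancel₀ ha0, one_smul]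
  filter_upwards [hlam, eventually_convergesAt lam,
    eventually_convergesAt (algebraMap ℂ (ConvSeries N) (Complex.log a)),
    eventually_convergesAt (algebraMap ℂ (ConvSeries N) a),
    eventually_convergesAt (1 + (a⁻¹ • u - 1))] with z h2 h3 h4 h5 h6
  rw [evalAt_add h4 h3, Complex.exp_add, h2, evalAt_algebraMap, Complex.exp_log ha0]
  conv_rhs => rw [← h1]
  rw [evalAt_mul h5 h6, evalAt_algebraMap]

/-! ### Wick contraction operators on tensor products -/

section Wick

open TensorProduct

variable {ι M P E : Type*} [AddCommMonoid M] [Module ℂ M] [AddCommMonoid P] [Module ℂ P]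
  [AddCommMonoid E] [Module ℂ E]

/-- The operator `∑ₓ ∂ₓ ⊗ Aₓ` on `M ⊗ P`, for a family `∂` of which only finitely many members
are nonzero on a given element. -/
def wickOp (d : ι → M →ₗ[ℂ] M) (A : ι → P →ₗ[ℂ] P) (hd : ∀ u, {x | d x u ≠ 0}.Finite) :
    M ⊗[ℂ] P →ₗ[ℂ] M ⊗[ℂ] P :=
  TensorProduct.lift (LinearMap.mk₂ ℂ (fun u q => ∑ᶠ x, d x u ⊗ₜ[ℂ] A x q)
    (fun u u' q => by
      have h (w : M) : (Function.support fun x => d x w ⊗ₜ[ℂ] A x q).Finite :=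
        (hd w).subset fun x hx h0 => hx (by simp [h0])
      simp only [map_add, TensorProduct.add_tmul]
      exact finsum_add_distrib (h u) (h u'))
    (fun c u q => by
      simp only [map_smul, ← TensorProduct.smul_tmul']
      exact (smul_finsum' c ((hd u).subset fun x hx h0 => hx (by simp [h0]))).symm)
    (fun u q q' => by
      have h (w : P) : (Function.support fun x => d x u ⊗ₜ[ℂ] A x w).Finite :=
        (hd u).subset fun x hx h0 => hx (by simp [h0])
      simp only [map_add, TensorProduct.tmul_add]
      exact finsum_add_distrib (h q) (h q'))
    (fun c u q => by
      simp only [map_smul, TensorProduct.tmul_smul]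
      exact (smul_finsum' c ((hd u).subset fun x hx h0 => hx (by simp [h0]))).symm))

variable {d : ι → M →ₗ[ℂ] M} {A : ι → P →ₗ[ℂ] P} {hd : ∀ u, {x | d x u ≠ 0}.Finite}

theorem wickOp_tmul {S : Finset ι} {u : M} (hS : ∀ x ∉ S, d x u = 0) (q : P) :
    wickOp d A hd (u ⊗ₜ q) = ∑ x ∈ S, d x u ⊗ₜ[ℂ] A x q := by
  simp only [wickOp, TensorProduct.lift.tmul, LinearMap.mk₂_apply]
  refine finsum_eq_sum_of_support_subset _ fun x hx => ?_
  by_contra h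
  exact hx (by simp [hS x h])

/-- The lists of length `k` with entries in `S`. -/
def listsOfLength [DecidableEq ι] (S : Finset ι) : ℕ → Finset (List ι)
  | 0 => {[]}
  | k + 1 => (S ×ˢ listsOfLength S k).image fun p => p.1 :: p.2

theorem mem_listsOfLength [DecidableEq ι] {S : Finset ι} {k : ℕ} {l : List ι} :
    l ∈ listsOfLength S k ↔ l.length = k ∧ ∀ x ∈ l, x ∈ S := by
  induction k generalizing l with
  | zero => cases l <;> simp [listsOfLength]
  | succ k ih =>
    cases l with
    | nil => simp [listsOfLength]
    | cons x l =>
      simp only [listsOfLength, Finset.mem_image, Finset.mem_product, Prod.exists, ih,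
        List.cons.injEq, List.length_cons, List.mem_cons, forall_eq_or_imp]
      constructor
      · rintro ⟨a, b, ⟨h1, h2, h3⟩, rfl, rfl⟩
        exact ⟨by omega, h1, h3⟩
      · rintro ⟨h1, h2, h3⟩
        exact ⟨x, l, ⟨h2, by omega, h3⟩, rfl, rfl⟩

theorem foldr_comm_apply (hcomm : ∀ x y u, d x (d y u) = d y (d x u)) (x : ι) (l : List ι)
    (u : M) : d x (l.foldr (fun y w => d y w) u) = l.foldr (fun y w => d y w) (d x u) := by
  induction l with
  | nil => rfl
  | cons y l ih => simp only [List.foldr_cons]; rw [hcomm, ih]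

theorem foldr_apply_zero (B : ι → P →ₗ[ℂ] P) (l : List ι) :
    l.foldr (fun y w => B y w) 0 = 0 := by
  induction l with
  | nil => rfl
  | cons y l ih => simp [ih]

theorem wickOp_pow_tmul [DecidableEq ι] (hcomm : ∀ x y u, d x (d y u) = d y (d x u))
    {S : Finset ι} {u : M} (hS : ∀ x ∉ S, d x u = 0) (q : P) (k : ℕ) :
    ((wickOp d A hd) ^ k) (u ⊗ₜ q) = ∑ l ∈ listsOfLength S k,
      l.foldr (fun x w => d x w) u ⊗ₜ[ℂ] l.foldr (fun x w => A x w) q := by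
  induction k with
  | zero => simp [listsOfLength]
  | succ k ih =>
    rw [pow_succ', Module.End.mul_apply, ih, map_sum, listsOfLength,
      Finset.sum_image (by rintro ⟨a, b⟩ _ ⟨c, e⟩ _ h; simpa using h), Finset.sum_product_right]
    refine Finset.sum_congr rfl fun l _ => ?_
    rw [wickOp_tmul (S := S)]
    · rfl
    · intro x hx
      rw [foldr_comm_apply hcomm, hS x hx, foldr_apply_zero]

/-- The sum over lists of the terms `∂ₓ₁⋯∂ₓₖ u ⊗ Aₓ₁⋯Aₓₖ q`, weighted by `1 / k!`, is the
exponential of `∑ₓ ∂ₓ ⊗ Aₓ`. -/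
theorem finsum_list_eq_sum_wickOp_pow (hcomm : ∀ x y u, d x (d y u) = d y (d x u))
    (μ : M ⊗[ℂ] P →ₗ[ℂ] E) {u : M} {q : P} {K : ℕ}
    (hK : ∀ l : List ι, K ≤ l.length →
      l.foldr (fun x w => d x w) u = 0 ∨ l.foldr (fun x w => A x w) q = 0) :
    ∑ᶠ l : List ι, ((l.length.factorial : ℂ)⁻¹) •
        μ (l.foldr (fun x w => d x w) u ⊗ₜ[ℂ] l.foldr (fun x w => A x w) q) =
      ∑ k ∈ Finset.range K, ((k.factorial : ℂ)⁻¹) • μ (((wickOp d A hd) ^ k) (u ⊗ₜ q)) := by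
  classical
  have hS : ∀ x ∉ (hd u).toFinset, d x u = 0 := fun x hx => by simpa using hx
  set S := (hd u).toFinset with hSdef
  rw [finsum_eq_sum_of_support_subset (s := (Finset.range K).biUnion (listsOfLength S))]
  · rw [Finset.sum_biUnion]
    · refine Finset.sum_congr rfl fun k _ => ?_
      rw [wickOp_pow_tmul hcomm hS, map_sum, Finset.smul_sum]
      refine Finset.sum_congr rfl fun l hl => ?_
      rw [(mem_listsOfLength.1 hl).1]
    · intro a _ b _ hab
      refine Finset.disjoint_left.2 fun l h1 h2 => hab ?_
      rw [← (mem_listsOfLength.1 h1).1, ← (mem_listsOfLength.1 h2).1]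
  · intro l hl
    rw [Finset.mem_coe, Finset.mem_biUnion]
    refine ⟨l.length, ?_, mem_listsOfLength.2 ⟨rfl, fun x hx => ?_⟩⟩
    · rw [Finset.mem_range]
      by_contra h
      refine hl ?_
      rcases hK l (not_lt.1 h) with h0 | h0 <;> simp [h0]
    · by_contra h
      refine hl ?_
      have h0 : l.foldr (fun x w => d x w) u = 0 := by
        obtain ⟨l₁, l₂, rfl⟩ := List.append_of_mem hx
        rw [List.foldr_append, List.foldr_cons, foldr_comm_apply hcomm, hS x h, foldr_apply_zero,
          foldr_apply_zero]
      simp [h0]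

/-- If `[∂ₓ₊₁, T] = wₓ ∂ₓ` and `[D, Aₓ] = wₓ Aₓ₊₁`, where `x ↦ x + 1` stands for `succ`, then
`∑ₓ ∂ₓ ⊗ Aₓ` commutes with `T ⊗ 1 + 1 ⊗ D`. -/
theorem wickOp_commute {succ : ι → ι} (hsucc : Function.Injective succ) {w : ι → ℂ}
    {T : M →ₗ[ℂ] M} {D : P →ₗ[ℂ] P}
    (h1 : ∀ x u, d (succ x) (T u) = T (d (succ x) u) + w x • d x u)
    (h2 : ∀ x ∉ Set.range succ, ∀ u, d x (T u) = T (d x u))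
    (h3 : ∀ x q, D (A x q) = A x (D q) + w x • A (succ x) q) :
    Commute (wickOp d A hd) (T.rTensor P + D.lTensor M) := by
  classical
  refine TensorProduct.ext' fun u q => ?_
  simp only [Module.End.mul_apply, LinearMap.add_apply, LinearMap.rTensor_tmul,
    LinearMap.lTensor_tmul, map_add]
  have hS₀ : ∀ x ∉ (hd u).toFinset, d x u = 0 := fun x hx => by simpa using hx
  set S₀ := (hd u).toFinset
  set S := S₀ ∪ S₀.image succ with hSdef
  have hS : ∀ x ∉ S, d x u = 0 := fun x hx => hS₀ x fun h => hx (Finset.mem_union_left _ h)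
  -- the commutator of `d x` with `T` vanishes on `u` unless `x` lies over the support of `u`
  have he : ∀ x ∉ S₀.image succ, d x (T u) = T (d x u) := by
    intro x hx
    by_cases hr : x ∈ Set.range succ
    · obtain ⟨y, rfl⟩ := hr
      rw [h1, hS₀ y fun h => hx (Finset.mem_image_of_mem _ h), smul_zero, add_zero]
    · exact h2 x hr u
  have hST : ∀ x ∉ S, d x (T u) = 0 := by
    intro x hx
    rw [he x fun h => hx (Finset.mem_union_right _ h), hS x hx, map_zero]
  rw [wickOp_tmul hST, wickOp_tmul hS, wickOp_tmul hS, map_sum, map_sum]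
  simp only [LinearMap.rTensor_tmul, LinearMap.lTensor_tmul, h3, TensorProduct.tmul_add,
    Finset.sum_add_distrib]
  have key : ∑ x ∈ S, d x (T u) ⊗ₜ[ℂ] A x q =
      ∑ x ∈ S, T (d x u) ⊗ₜ[ℂ] A x q + ∑ x ∈ S, d x u ⊗ₜ[ℂ] (w x • A (succ x) q) := by
    have hterm : ∀ x ∈ S, d x (T u) ⊗ₜ[ℂ] A x q = T (d x u) ⊗ₜ[ℂ] A x q +
        ∑ y ∈ S₀, if succ y = x then d y u ⊗ₜ[ℂ] (w y • A (succ y) q) else 0 := by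
      intro x _
      by_cases hx : x ∈ S₀.image succ
      · obtain ⟨y, hy, rfl⟩ := Finset.mem_image.1 hx
        simp only [hsucc.eq_iff]
        rw [Finset.sum_ite_eq', if_pos hy, h1, TensorProduct.add_tmul, TensorProduct.smul_tmul]
      · rw [he x hx, Finset.sum_eq_zero, add_zero]
        intro y hy
        rw [if_neg]
        rintro rfl
        exact hx (Finset.mem_image_of_mem _ hy)
    rw [Finset.sum_congr rfl hterm, Finset.sum_add_distrib]
    congr 1
    rw [Finset.sum_comm, ← Finset.sum_subset Finset.subset_union_left]
    · refine Finset.sum_congr rfl fun y hy => ?_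
      rw [Finset.sum_ite_eq, if_pos (Finset.mem_union_right _ (Finset.mem_image_of_mem _ hy))]
    · intro x _ hx
      rw [hS₀ x hx, TensorProduct.zero_tmul]
  rw [key]
  abel

end Wick

/-! ### Derivations of the space of states -/

variable {N : ℕ}

theorem coeff_delCoeff (i : Fin N) (u : CDO N) (m : Creation N →₀ ℕ) :
    (delCoeff i u).coeff m = del i (u.coeff m) := by
  classical
  rw [delCoeff, MvPolynomial.coeff_sum]
  simp only [MvPolynomial.coeff_monomial]
  rw [Finset.sum_ite_eq']
  split_ifs with h
  · rfl
  · rw [MvPolynomial.notMem_support_iff.1 h, map_zero]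

theorem delCoeff_monomial (i : Fin N) (m : Creation N →₀ ℕ) (f : ConvSeries N) :
    delCoeff i (MvPolynomial.monomial m f) = MvPolynomial.monomial m (del i f) := by
  classical
  ext1 n
  rw [coeff_delCoeff, MvPolynomial.coeff_monomial, MvPolynomial.coeff_monomial]
  split_ifs <;> simp

theorem delCoeff_add (i : Fin N) (u v : CDO N) :
    delCoeff i (u + v) = delCoeff i u + delCoeff i v := by
  ext1 n
  simp [coeff_delCoeff]

theorem delCoeff_smul (i : Fin N) (c : ℂ) (u : CDO N) : delCoeff i (c • u) = c • delCoeff i u := by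
  ext1 n
  simp [coeff_delCoeff]

theorem delCoeff_mul (i : Fin N) (u v : CDO N) :
    delCoeff i (u * v) = u * delCoeff i v + v * delCoeff i u := by
  induction u using MvPolynomial.induction_on' with
  | add p q hp hq => rw [add_mul, delCoeff_add, hp, hq, delCoeff_add]; ring
  | monomial m f =>
    induction v using MvPolynomial.induction_on' with
    | add p q hp hq => rw [mul_add, delCoeff_add, hp, hq, delCoeff_add]; ring
    | monomial n g =>
      simp only [MvPolynomial.monomial_mul, delCoeff_monomial, del_mul, map_add]
      rw [add_comm n m]

theorem delGen_mul (x : Gen N) (u v : CDO N) :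
    delGen x (u * v) = u * delGen x v + v * delGen x u := by
  rcases x with ⟨i, _ | n⟩ | ⟨i, n⟩
  · exact delCoeff_mul i u v
  · exact (MvPolynomial.pderiv (Creation.b i n)).leibniz u v
  · exact (MvPolynomial.pderiv (Creation.a i n)).leibniz u v

/-- `delGen x` as a linear map. -/
def delGenₗ : Gen N → CDO N →ₗ[ℂ] CDO N
  | Gen.b i 0 => ⟨⟨delCoeff i, delCoeff_add i⟩, delCoeff_smul i⟩
  | Gen.b i (n + 1) => (MvPolynomial.pderiv (Creation.b i n)).toLinearMap.restrictScalars ℂ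
  | Gen.a i n => (MvPolynomial.pderiv (Creation.a i n)).toLinearMap.restrictScalars ℂ

theorem delGenₗ_apply (x : Gen N) (u : CDO N) : delGenₗ x u = delGen x u := by
  rcases x with ⟨i, _ | n⟩ | ⟨i, n⟩ <;> rfl

theorem delGen_zero (x : Gen N) : delGen x (0 : CDO N) = 0 := by
  simpa only [delGenₗ_apply] using map_zero (delGenₗ x)

theorem delGen_add (x : Gen N) (u v : CDO N) : delGen x (u + v) = delGen x u + delGen x v := by
  simpa only [delGenₗ_apply] using map_add (delGenₗ x) u v

theorem delGen_smul (x : Gen N) (c : ℂ) (u : CDO N) : delGen x (c • u) = c • delGen x u := by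
  simpa only [delGenₗ_apply] using map_smul (delGenₗ x) c u

theorem delGen_sum {κ : Type*} (x : Gen N) (s : Finset κ) (f : κ → CDO N) :
    delGen x (∑ k ∈ s, f k) = ∑ k ∈ s, delGen x (f k) := by
  simpa only [delGenₗ_apply] using map_sum (delGenₗ x) f s

theorem translation_add (u v : CDO N) :
    translation (u + v) = translation u + translation v := by
  simp only [translation, delCoeff_add, add_mul, Finset.sum_add_distrib, map_add]
  abel

theorem translation_smul (c : ℂ) (u : CDO N) : translation (c • u) = c • translation u := by
  have h (D : Derivation (ConvSeries N) (CDO N) (CDO N)) : D (c • u) = c • D u := by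
    rw [← algebraMap_smul (ConvSeries N) c u, D.map_smul, algebraMap_smul]
  rw [translation, translation, h, smul_add, Finset.smul_sum]
  congr 1
  refine Finset.sum_congr rfl fun i _ => ?_
  rw [delCoeff_smul, smul_mul_assoc]

/-- The translation operator as a linear map. -/
def translationₗ : CDO N →ₗ[ℂ] CDO N := ⟨⟨translation, translation_add⟩, translation_smul⟩

theorem translationₗ_apply (u : CDO N) : translationₗ u = translation u := rfl

theorem translation_zero : translation (0 : CDO N) = 0 := map_zero translationₗ

theorem translation_sum {κ : Type*} (s : Finset κ) (f : κ → CDO N) :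
    translation (∑ k ∈ s, f k) = ∑ k ∈ s, translation (f k) := map_sum translationₗ f s

theorem translation_mul (u v : CDO N) :
    translation (u * v) = u * translation v + v * translation u := by
  simp only [translation, delCoeff_mul, Derivation.leibniz, smul_eq_mul, add_mul,
    Finset.sum_add_distrib, mul_add, Finset.mul_sum, mul_assoc]
  abel

theorem translation_one : translation (1 : CDO N) = 0 := by
  simpa using translation_mul (1 : CDO N) 1

theorem delGen_one (x : Gen N) : delGen x (1 : CDO N) = 0 := by
  simpa using delGen_mul x (1 : CDO N) 1

open scoped Classical in
theorem delGen_X (x : Gen N) (y : Creation N) :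
    delGen x (MvPolynomial.X y) = if x = y.toGen then 1 else 0 := by
  have h0 (i : Fin N) : delCoeff i (MvPolynomial.X y) = 0 := by
    rw [MvPolynomial.X, delCoeff_monomial]
    have : del i (1 : ConvSeries N) = 0 := by simpa using del_mul i 1 1
    rw [this, map_zero]
  rcases x with ⟨i, _ | n⟩ | ⟨i, n⟩ <;> rcases y with ⟨j, k⟩ | ⟨j, k⟩ <;>
    simp [delGen, Creation.toGen, h0, MvPolynomial.pderiv_X, Pi.single_apply, eq_comm]

theorem delCoeff_C (i : Fin N) (f : ConvSeries N) :
    delCoeff i (MvPolynomial.C f) = MvPolynomial.C (del i f) := by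
  rw [MvPolynomial.C_apply, MvPolynomial.C_apply, delCoeff_monomial]

theorem delGen_b_zero_C (i : Fin N) (f : ConvSeries N) :
    delGen (Gen.b i 0) (MvPolynomial.C f) = MvPolynomial.C (del i f) :=
  delCoeff_C i f

/-- The successor `T⁽ⁿ⁾x ↦ T⁽ⁿ⁺¹⁾x`. -/
def Gen.succ : Gen N → Gen N
  | Gen.b i n => Gen.b i (n + 1)
  | Gen.a i n => Gen.a i (n + 1)

/-- The factor in `T (T⁽ⁿ⁾x) = (n + 1) T⁽ⁿ⁺¹⁾x`. -/
def Gen.weight : Gen N → ℂ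
  | Gen.b _ n => n + 1
  | Gen.a _ n => n + 1

/-- The creation operator following a given one under translation. -/
def Creation.succ : Creation N → Creation N
  | Creation.b i n => Creation.b i (n + 1)
  | Creation.a i n => Creation.a i (n + 1)

theorem Gen.succ_injective : Function.Injective (Gen.succ (N := N)) := by
  rintro (⟨i, n⟩ | ⟨i, n⟩) (⟨j, k⟩ | ⟨j, k⟩) h <;>
    simp_all [Gen.succ]

theorem Creation.toGen_succ (y : Creation N) : y.succ.toGen = y.toGen.succ := by
  cases y <;> rfl

theorem delGen_C_of_ne {x : Gen N} (hx : ∀ i, x ≠ Gen.b i 0) (f : ConvSeries N) :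
    delGen x (MvPolynomial.C f) = 0 := by
  rcases x with ⟨i, _ | n⟩ | ⟨i, n⟩
  · exact absurd rfl (hx i)
  · exact MvPolynomial.pderiv_C
  · exact MvPolynomial.pderiv_C

theorem translation_C (f : ConvSeries N) : translation (MvPolynomial.C f : CDO N) =
    ∑ i, MvPolynomial.C (del i f) * MvPolynomial.X (Creation.b i 0) := by
  rw [translation, MvPolynomial.derivation_C, add_zero]
  exact Finset.sum_congr rfl fun i _ => by rw [delCoeff_C]

theorem translation_X (y : Creation N) :
    translation (MvPolynomial.X y : CDO N) = y.toGen.weight • MvPolynomial.X y.succ := by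
  have h (i : Fin N) : delCoeff i (MvPolynomial.X y) = 0 := by
    classical
    have := delGen_X (Gen.b i 0) y
    rw [if_neg (by cases y <;> simp [Creation.toGen])] at this
    exact this
  rw [translation]
  simp only [h, zero_mul, Finset.sum_const_zero, zero_add, MvPolynomial.mkDerivation_X]
  cases y
  · simp only [Creation.toGen, Gen.weight, Creation.succ]
    push_cast
    ring_nf
  · rfl

theorem delGen_delGen_X (x y : Gen N) (z : Creation N) :
    delGen x (delGen y (MvPolynomial.X z)) = 0 := by
  classical
  rw [delGen_X]
  split_ifs
  · exact delGen_one x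
  · exact delGen_zero x

theorem translation_delGen_X (x : Gen N) (z : Creation N) :
    translation (delGen x (MvPolynomial.X z)) = 0 := by
  classical
  rw [delGen_X]
  split_ifs
  · exact translation_one
  · exact translation_zero

theorem delGen_comm (x y : Gen N) (u : CDO N) :
    delGen x (delGen y u) = delGen y (delGen x u) := by
  induction u using MvPolynomial.induction_on with
  | C f =>
    by_cases hx : ∃ i, x = Gen.b i 0 <;> by_cases hy : ∃ j, y = Gen.b j 0
    · obtain ⟨i, rfl⟩ := hx
      obtain ⟨j, rfl⟩ := hy
      simp only [delGen_b_zero_C, del_comm i j]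
    · obtain ⟨i, rfl⟩ := hx
      rw [delGen_b_zero_C, delGen_C_of_ne (fun i h => hy ⟨i, h⟩),
        delGen_C_of_ne (fun i h => hy ⟨i, h⟩), delGen_zero]
    · obtain ⟨j, rfl⟩ := hy
      rw [delGen_b_zero_C, delGen_C_of_ne (fun i h => hx ⟨i, h⟩),
        delGen_C_of_ne (fun i h => hx ⟨i, h⟩), delGen_zero]
    · rw [delGen_C_of_ne (fun i h => hx ⟨i, h⟩), delGen_C_of_ne (fun i h => hy ⟨i, h⟩),
        delGen_zero, delGen_zero]
  | add p q hp hq => simp only [delGen_add, hp, hq]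
  | mul_X p z hp =>
    simp only [delGen_mul, delGen_add, delGen_delGen_X, hp]
    ring

/-- `[∂_{T⁽ⁿ⁺¹⁾x}, T] = (n + 1) ∂_{T⁽ⁿ⁾x}`. -/
theorem delGen_succ_translation (x : Gen N) (u : CDO N) :
    delGen x.succ (translation u) = translation (delGen x.succ u) + x.weight • delGen x u := by
  classical
  have hxs (i : Fin N) : x.succ ≠ Gen.b i 0 := by cases x <;> simp [Gen.succ]
  induction u using MvPolynomial.induction_on with
  | C f =>
    rw [delGen_C_of_ne hxs, translation_zero, zero_add, translation_C, delGen_sum]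
    simp only [delGen_mul, delGen_C_of_ne hxs, delGen_X, mul_zero, add_zero]
    by_cases hx : ∃ i, x = Gen.b i 0
    · obtain ⟨i, rfl⟩ := hx
      simp [delGen_b_zero_C, Gen.succ, Creation.toGen, Gen.weight]
    · rw [delGen_C_of_ne (fun i h => hx ⟨i, h⟩), smul_zero]
      refine Finset.sum_eq_zero fun i _ => ?_
      rw [if_neg, mul_zero]
      intro h
      exact hx ⟨i, Gen.succ_injective h⟩
  | add p q hp hq =>
    simp only [delGen_add, translation_add, hp, hq, smul_add]
    abel
  | mul_X p y hp =>
    have hX : delGen x.succ (translation (MvPolynomial.X y)) =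
        x.weight • delGen x (MvPolynomial.X y) := by
      rw [translation_X, delGen_smul, delGen_X, delGen_X, Creation.toGen_succ]
      by_cases hy : x = y.toGen
      · subst hy; simp
      · rw [if_neg hy, if_neg fun h => hy (Gen.succ_injective h), smul_zero, smul_zero]
    simp only [translation_mul, delGen_mul, delGen_add, translation_add, hp, hX,
      translation_delGen_X, smul_add, mul_add, mul_smul_comm]
    ring

theorem delGen_translation_of_notMem_range {x : Gen N} (hx : x ∉ Set.range Gen.succ) (u : CDO N) :
    delGen x (translation u) = translation (delGen x u) := by
  classical
  induction u using MvPolynomial.induction_on with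
  | C f =>
    have hb (i : Fin N) : delGen x (MvPolynomial.X (Creation.b i 0)) = 0 := by
      rw [delGen_X, if_neg]
      rintro rfl
      exact hx ⟨Gen.b i 0, rfl⟩
    rw [translation_C, delGen_sum]
    simp only [delGen_mul, hb, mul_zero, zero_add]
    by_cases hx0 : ∃ i, x = Gen.b i 0
    · obtain ⟨i, rfl⟩ := hx0
      simp only [delGen_b_zero_C, translation_C, del_comm i, mul_comm]
    · simp only [delGen_C_of_ne (fun i h => hx0 ⟨i, h⟩), mul_zero, Finset.sum_const_zero,
        translation_zero]
  | add p q hp hq => simp only [delGen_add, translation_add, hp, hq]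
  | mul_X p y hp =>
    have hX : delGen x (MvPolynomial.X y.succ) = 0 := by
      rw [delGen_X, if_neg]
      rintro rfl
      exact hx ⟨_, (Creation.toGen_succ y).symm⟩
    have hTX : delGen x (translation (MvPolynomial.X y)) = 0 := by
      rw [translation_X, delGen_smul, hX, smul_zero]
    simp only [translation_mul, delGen_mul, delGen_add, translation_add, hp, hTX,
      translation_delGen_X]
    ring

theorem finite_setOf_delGen_ne_zero (u : CDO N) : {x | delGen x u ≠ 0}.Finite := by
  classical
  refine ((Set.finite_range fun i : Fin N => Gen.b i 0).union
    (u.vars.finite_toSet.image Creation.toGen)).subset fun x hx => ?_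
  by_contra h
  rw [Set.mem_union, not_or] at h
  refine hx ?_
  rcases x with ⟨i, _ | n⟩ | ⟨i, n⟩
  · exact absurd ⟨i, rfl⟩ h.1
  · refine MvPolynomial.pderiv_eq_zero_of_notMem_vars fun hv => h.2 ⟨_, hv, rfl⟩
  · refine MvPolynomial.pderiv_eq_zero_of_notMem_vars fun hv => h.2 ⟨_, hv, rfl⟩

/-! ### Annihilation operators -/

theorem annihilate_add (x : Gen N) (u v : CDO N) :
    annihilate x (u + v) = annihilate x u + annihilate x v := by
  simp only [annihilate, delCoeff_add, map_add, add_mul, Finset.sum_add_distrib]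
  abel

theorem annihilate_smul (x : Gen N) (c : ℂ) (u : CDO N) :
    annihilate x (c • u) = c • annihilate x u := by
  have h (D : Derivation (ConvSeries N) (CDO N) (Polynomial (CDO N))) : D (c • u) = c • D u := by
    rw [← algebraMap_smul (ConvSeries N) c u, D.map_smul, algebraMap_smul]
  rw [annihilate, annihilate, h, smul_add, Finset.smul_sum]
  congr 1
  refine Finset.sum_congr rfl fun i _ => ?_
  rw [delCoeff_smul, ← Polynomial.smul_C, smul_mul_assoc]

theorem annihilate_zero (x : Gen N) : annihilate x (0 : CDO N) = 0 := by
  simpa using annihilate_smul x 0 (0 : CDO N)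

theorem annihilatePoly_add (x : Gen N) (p q : Polynomial (CDO N)) :
    annihilatePoly x (p + q) = annihilatePoly x p + annihilatePoly x q :=
  Polynomial.sum_add_index _ _ _ (fun _ => by rw [annihilate_zero, zero_mul])
    fun _ _ _ => by rw [annihilate_add, add_mul]

theorem annihilatePoly_smul (x : Gen N) (c : ℂ) (p : Polynomial (CDO N)) :
    annihilatePoly x (c • p) = c • annihilatePoly x p := by
  rw [annihilatePoly, Polynomial.sum_smul_index' _ _ _ fun _ => by rw [annihilate_zero, zero_mul],
    annihilatePoly, Polynomial.smul_sum]
  simp only [annihilate_smul, smul_mul_assoc]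

/-- `annihilatePoly x` as a linear map. -/
def annihilatePolyₗ (x : Gen N) : Polynomial (CDO N) →ₗ[ℂ] Polynomial (CDO N) :=
  ⟨⟨annihilatePoly x, annihilatePoly_add x⟩, annihilatePoly_smul x⟩

theorem annihilatePolyₗ_apply (x : Gen N) (q : Polynomial (CDO N)) :
    annihilatePolyₗ x q = annihilatePoly x q := rfl

theorem annihilatePoly_monomial (x : Gen N) (p : ℕ) (v : CDO N) :
    annihilatePoly x (Polynomial.monomial p v) = annihilate x v * Polynomial.X ^ p :=
  Polynomial.sum_monomial_index _ _ (by rw [annihilate_zero, zero_mul])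

theorem annihilatePoly_C (x : Gen N) (v : CDO N) :
    annihilatePoly x (Polynomial.C v) = annihilate x v := by
  rw [← Polynomial.monomial_zero_left, annihilatePoly_monomial, pow_zero, mul_one]

/-- The derivative with respect to `z` of a polynomial in `z⁻¹`. -/
def derivZ : Polynomial (CDO N) →ₗ[CDO N] Polynomial (CDO N) :=
  (-1 : ℂ) •
    (LinearMap.mulLeft (CDO N) (Polynomial.X ^ 2 : Polynomial (CDO N)) ∘ₗ Polynomial.derivative)

theorem derivZ_apply (q : Polynomial (CDO N)) :
    derivZ q = (-1 : ℂ) • (Polynomial.X ^ 2 * Polynomial.derivative q) := rfl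

theorem derivZ_mul (p q : Polynomial (CDO N)) :
    derivZ (p * q) = p * derivZ q + q * derivZ p := by
  rw [derivZ_apply, derivZ_apply, derivZ_apply, Polynomial.derivative_mul, mul_smul_comm,
    mul_smul_comm, ← smul_add]
  congr 1
  ring

theorem derivZ_C (v : CDO N) : derivZ (Polynomial.C v) = 0 := by
  rw [derivZ_apply, Polynomial.derivative_C, mul_zero, smul_zero]

theorem derivZ_monomial (p : ℕ) (v : CDO N) :
    derivZ (Polynomial.monomial p v) = (-(p : ℂ)) • Polynomial.monomial (p + 1) v := by
  rw [derivZ_apply, Polynomial.derivative_monomial, neg_eq_neg_one_mul (p : ℂ), mul_smul]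
  rcases p with _ | p
  · simp
  · rw [Polynomial.X_pow_mul_monomial, Polynomial.smul_monomial ((p + 1 : ℕ) : ℂ),
      add_tsub_cancel_right]
    congr 2
    rw [mul_comm, ← nsmul_eq_mul, Nat.cast_smul_eq_nsmul]

theorem derivZ_smul (c : ℂ) (q : Polynomial (CDO N)) : derivZ (c • q) = c • derivZ q := by
  rw [derivZ_apply, derivZ_apply, Polynomial.derivative_smul, mul_smul_comm, smul_comm]

/-- `derivZ` as a `ℂ`-linear map. -/
def derivZₗ : Polynomial (CDO N) →ₗ[ℂ] Polynomial (CDO N) :=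
  ⟨⟨derivZ, map_add derivZ⟩, derivZ_smul⟩

theorem derivZ_X_pow (k : ℕ) : derivZ (Polynomial.X ^ k : Polynomial (CDO N)) =
    (-(k : ℂ)) • Polynomial.X ^ (k + 1) := by
  rw [Polynomial.X_pow_eq_monomial, derivZ_monomial, Polynomial.X_pow_eq_monomial]

/-- The contractions with `T⁽ⁿ⁺¹⁾x` are obtained from those with `T⁽ⁿ⁾x` by differentiation. -/
theorem derivZ_contraction (x y : Gen N) :
    derivZ (contraction x y) = x.weight • contraction x.succ y := by
  have key (m n : ℕ) : ((m : ℂ) + n + 1) * ((m + n).choose m : ℂ) =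
      (m + 1) * ((m + 1 + n).choose (m + 1) : ℂ) := by
    have h := Nat.add_one_mul_choose_eq (m + n) m
    have h2 : (((m + n + 1) * (m + n).choose m : ℕ) : ℂ) =
        ((m + n + 1).choose (m + 1) * (m + 1) : ℕ) := by rw [h]
    push_cast at h2
    rw [h2, mul_comm, show m + 1 + n = m + n + 1 by ring]
  rcases x with ⟨i, n⟩ | ⟨i, n⟩ <;> rcases y with ⟨j, m⟩ | ⟨j, m⟩ <;>
    simp only [contraction, Gen.succ, Gen.weight, map_zero, smul_zero]
  · by_cases h : i = j
    · rw [if_pos h, if_pos h, derivZ_smul, derivZ_X_pow, smul_smul, smul_smul]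
      have := key n m
      rw [show m + n + 1 + 1 = m + (n + 1) + 1 by ring, show m + (n + 1) = n + 1 + m by ring,
        show m + n = n + m by ring]
      congr 1
      push_cast
      linear_combination ((-1) ^ n) * this
    · rw [if_neg h, if_neg h, map_zero, smul_zero]
  · by_cases h : i = j
    · rw [if_pos h, if_pos h, derivZ_smul, derivZ_X_pow, smul_smul, smul_smul]
      have := key n m
      rw [show n + m + 1 + 1 = n + 1 + m + 1 by ring]
      congr 1
      push_cast
      linear_combination (-(-1) ^ n) * this
    · rw [if_neg h, if_neg h, map_zero, smul_zero]

theorem derivZ_annihilate (x : Gen N) (v : CDO N) :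
    derivZ (annihilate x v) = x.weight • annihilate x.succ v := by
  have hd (m : Creation N →₀ ℕ) (f : ConvSeries N) :
      derivZ (MvPolynomial.mkDerivation (ConvSeries N) (A := Polynomial (CDO N))
        (fun y : Creation N => contraction x y.toGen) (MvPolynomial.monomial m f)) =
      x.weight • MvPolynomial.mkDerivation (ConvSeries N) (A := Polynomial (CDO N))
        (fun y : Creation N => contraction x.succ y.toGen) (MvPolynomial.monomial m f) := by
    have hs (q : Polynomial (CDO N)) : derivZ (f • q) = f • derivZ q := by
      rw [derivZ_apply, derivZ_apply, Polynomial.derivative_smul, mul_smul_comm, smul_comm]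
    rw [MvPolynomial.mkDerivation_monomial, MvPolynomial.mkDerivation_monomial, hs,
      Finsupp.sum, Finsupp.sum, map_sum, smul_comm x.weight f, Finset.smul_sum (r := x.weight)]
    congr 1
    refine Finset.sum_congr rfl fun y _ => ?_
    rw [map_smul, derivZ_contraction, smul_comm]
  induction v using MvPolynomial.induction_on' with
  | add p q hp hq => rw [annihilate_add, map_add, hp, hq, annihilate_add, smul_add]
  | monomial m f =>
    rw [annihilate, annihilate, map_add, hd, smul_add, map_sum, Finset.smul_sum]
    refine congrArg₂ (· + ·) (Finset.sum_congr rfl fun i _ => ?_) rfl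
    rw [derivZ_mul, derivZ_C, mul_zero, add_zero, derivZ_contraction, mul_smul_comm]

theorem derivZ_annihilatePoly (x : Gen N) (q : Polynomial (CDO N)) :
    derivZ (annihilatePoly x q) =
      annihilatePoly x (derivZ q) + x.weight • annihilatePoly x.succ q := by
  induction q using Polynomial.induction_on' with
  | add p q hp hq =>
    simp only [annihilatePoly_add, map_add, hp, hq, smul_add]
    abel
  | monomial p v =>
    rw [annihilatePoly_monomial, derivZ_mul, derivZ_annihilate, derivZ_X_pow, derivZ_monomial,
      annihilatePoly_smul, annihilatePoly_monomial, annihilatePoly_monomial,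
      mul_smul_comm, mul_smul_comm, mul_comm (Polynomial.X ^ p)]

/-! ### The filtration by the degree in the creation operators `a` -/

/-- The weight of a creation operator: `1` for `aⁱ₋ₙ` and `0` for `bⁱ₋ₙ`. -/
def Creation.aWeight : Creation N → ℕ
  | Creation.b _ _ => 0
  | Creation.a _ _ => 1

/-- Whether an element of `Gen` is one of the states `T⁽ⁿ⁾aⁱ`. -/
def Gen.isA : Gen N → Bool
  | Gen.b _ _ => false
  | Gen.a _ _ => true

/-- The states of degree less than `d` in the creation operators `aⁱ₋ₙ`. -/
def aFiltration (N d : ℕ) : Submodule ℂ (CDO N) where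
  carrier := {u | ∀ m, u.coeff m ≠ 0 → Finsupp.weight Creation.aWeight m < d}
  add_mem' := by
    intro u v hu hv m hm
    by_contra h
    refine hm ?_
    rw [MvPolynomial.coeff_add, not_ne_iff.1 (mt (hu m) h), not_ne_iff.1 (mt (hv m) h), add_zero]
  zero_mem' := fun m hm => absurd (MvPolynomial.coeff_zero m) hm
  smul_mem' := by
    intro c u hu m hm
    refine hu m fun h => hm ?_
    rw [MvPolynomial.coeff_smul, h, smul_zero]

theorem aFiltration_zero {u : CDO N} (hu : u ∈ aFiltration N 0) : u = 0 := by
  ext1 m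
  by_contra h
  exact absurd (hu m h) (Nat.not_lt_zero _)

theorem exists_mem_aFiltration (u : CDO N) : ∃ d, u ∈ aFiltration N d := by
  refine ⟨u.support.sup (fun m => Finsupp.weight Creation.aWeight m) + 1, fun m hm => ?_⟩
  exact Nat.lt_succ_of_le (Finset.le_sup (f := fun m => Finsupp.weight Creation.aWeight m)
    (MvPolynomial.mem_support_iff.2 hm))

theorem monomial_mem_aFiltration {d : ℕ} {m : Creation N →₀ ℕ} (f : ConvSeries N)
    (hm : Finsupp.weight Creation.aWeight m < d) :
    MvPolynomial.monomial m f ∈ aFiltration N d := by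
  classical
  intro n hn
  rw [MvPolynomial.coeff_monomial] at hn
  split_ifs at hn with h
  · rwa [← h]
  · exact absurd rfl hn

theorem aFiltration_le_of_monomial {E : Type*} [AddCommMonoid E] {d : ℕ} (L : CDO N → E)
    (hL0 : L 0 = 0) (hL : ∀ u v, L (u + v) = L u + L v) (G : AddSubmonoid E)
    (h : ∀ m f, Finsupp.weight Creation.aWeight m < d → L (MvPolynomial.monomial m f) ∈ G)
    {u : CDO N} (hu : u ∈ aFiltration N d) : L u ∈ G := by
  rw [MvPolynomial.as_sum u]
  let L' : CDO N →+ E := ⟨⟨L, hL0⟩, hL⟩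
  change L' _ ∈ G
  rw [map_sum]
  exact G.sum_mem fun m hm => h m _ (hu m (MvPolynomial.mem_support_iff.1 hm))

theorem weight_sub_single {m : Creation N →₀ ℕ} {y : Creation N} (hy : m y ≠ 0) :
    Finsupp.weight Creation.aWeight (m - Finsupp.single y 1) + y.aWeight =
      Finsupp.weight Creation.aWeight m := by
  have h : m - Finsupp.single y 1 + Finsupp.single y 1 = m :=
    tsub_add_cancel_of_le (by rw [Finsupp.single_le_iff]; omega)
  conv_rhs => rw [← h]
  rw [map_add, Finsupp.weight_single, one_smul]

theorem pderiv_mem_aFiltration {d : ℕ} {u : CDO N} (hu : u ∈ aFiltration N d) (y : Creation N) :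
    MvPolynomial.pderiv y u ∈ aFiltration N (d - y.aWeight) := by
  refine aFiltration_le_of_monomial (fun u => MvPolynomial.pderiv y u) (map_zero _) (map_add _)
    (aFiltration N (d - y.aWeight)).toAddSubmonoid (fun m f hm => ?_) hu
  change MvPolynomial.pderiv y _ ∈ aFiltration N (d - y.aWeight)
  rw [MvPolynomial.pderiv_monomial]
  by_cases h0 : m y = 0
  · rw [h0, Nat.cast_zero, mul_zero, map_zero]
    exact zero_mem _
  · refine monomial_mem_aFiltration _ ?_
    have := weight_sub_single h0
    omega

theorem delCoeff_mem_aFiltration {d : ℕ} {u : CDO N} (hu : u ∈ aFiltration N d) (i : Fin N) :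
    delCoeff i u ∈ aFiltration N d := by
  intro m hm
  refine hu m fun h => hm ?_
  rw [coeff_delCoeff, h, map_zero]

theorem delGen_mem_aFiltration {d : ℕ} {u : CDO N} (hu : u ∈ aFiltration N d) (x : Gen N) :
    delGen x u ∈ aFiltration N (if x.isA then d - 1 else d) := by
  rcases x with ⟨i, _ | n⟩ | ⟨i, n⟩
  · exact delCoeff_mem_aFiltration hu i
  · exact pderiv_mem_aFiltration hu (Creation.b i n)
  · exact pderiv_mem_aFiltration hu (Creation.a i n)

/-- The polynomials in `z⁻¹` with coefficients of degree less than `d` in the creation operators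
`aⁱ₋ₙ`. -/
def aFiltrationPoly (N d : ℕ) : Submodule ℂ (Polynomial (CDO N)) where
  carrier := {q | ∀ p, q.coeff p ∈ aFiltration N d}
  add_mem' := fun {q r} hq hr p => by
    rw [Polynomial.coeff_add]
    exact add_mem (hq p) (hr p)
  zero_mem' := fun p => by
    rw [Polynomial.coeff_zero]
    exact zero_mem _
  smul_mem' := fun c q hq p => by
    rw [Polynomial.coeff_smul]
    exact Submodule.smul_mem _ c (hq p)

theorem mul_X_pow_mem_aFiltrationPoly {d : ℕ} {q : Polynomial (CDO N)}
    (hq : q ∈ aFiltrationPoly N d) (k : ℕ) : q * Polynomial.X ^ k ∈ aFiltrationPoly N d := by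
  intro p
  rw [Polynomial.coeff_mul_X_pow']
  split_ifs
  · exact hq _
  · exact zero_mem _

theorem C_mem_aFiltrationPoly {d : ℕ} {u : CDO N} (hu : u ∈ aFiltration N d) :
    Polynomial.C u ∈ aFiltrationPoly N d := by
  intro p
  rw [Polynomial.coeff_C]
  split_ifs
  · exact hu
  · exact zero_mem _

/-- A nonzero contraction pairs a generator of type `a` with one of type `b`. -/
theorem C_mul_contraction_mem {d : ℕ} {u : CDO N} {x y : Gen N}
    (h : x.isA ≠ y.isA → u ∈ aFiltration N d) :
    Polynomial.C u * contraction x y ∈ aFiltrationPoly N d := by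
  rcases x with ⟨i, n⟩ | ⟨i, n⟩ <;> rcases y with ⟨j, m⟩ | ⟨j, m⟩ <;> simp only [contraction]
  · rw [mul_zero]
    exact zero_mem _
  · split_ifs
    · rw [mul_smul_comm]
      exact Submodule.smul_mem _ _
        (mul_X_pow_mem_aFiltrationPoly (C_mem_aFiltrationPoly (h (by simp [Gen.isA]))) _)
    · rw [mul_zero]
      exact zero_mem _
  · split_ifs
    · rw [mul_smul_comm]
      exact Submodule.smul_mem _ _
        (mul_X_pow_mem_aFiltrationPoly (C_mem_aFiltrationPoly (h (by simp [Gen.isA]))) _)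
    · rw [mul_zero]
      exact zero_mem _
  · rw [mul_zero]
    exact zero_mem _

theorem annihilate_monomial (x : Gen N) (m : Creation N →₀ ℕ) (f : ConvSeries N) :
    annihilate x (MvPolynomial.monomial m f) =
      ∑ i, Polynomial.C (MvPolynomial.monomial m (del i f)) * contraction x (Gen.b i 0) +
        ∑ y ∈ m.support, Polynomial.C (MvPolynomial.monomial (m - Finsupp.single y 1)
          (f * (m y : ConvSeries N))) * contraction x y.toGen := by
  rw [annihilate, MvPolynomial.mkDerivation_monomial, Finsupp.sum, Finset.smul_sum]
  simp only [delCoeff_monomial]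
  refine congrArg₂ (· + ·) rfl (Finset.sum_congr rfl fun y _ => ?_)
  rw [← smul_assoc, MvPolynomial.smul_monomial, smul_eq_mul, Polynomial.smul_eq_C_mul]

theorem annihilate_mem_aFiltrationPoly {d : ℕ} {v : CDO N} (hv : v ∈ aFiltration N d) (x : Gen N) :
    annihilate x v ∈ aFiltrationPoly N (if !x.isA then d - 1 else d) := by
  refine aFiltration_le_of_monomial (annihilate x) (annihilate_zero x) (annihilate_add x)
    (aFiltrationPoly N (if !x.isA then d - 1 else d)).toAddSubmonoid (fun m f hm => ?_) hv
  change annihilate x _ ∈ aFiltrationPoly N (if !x.isA then d - 1 else d)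
  rw [annihilate_monomial]
  refine add_mem (sum_mem fun i _ => C_mul_contraction_mem fun h => ?_)
    (sum_mem fun y hy => C_mul_contraction_mem fun h => ?_)
  · have hx : x.isA = true := by simpa [Gen.isA] using h
    rw [hx]
    exact monomial_mem_aFiltration _ hm
  · refine monomial_mem_aFiltration _ ?_
    have h1 := weight_sub_single (Finsupp.mem_support_iff.1 hy)
    rcases x with ⟨i, n⟩ | ⟨i, n⟩ <;> rcases y with ⟨j, k⟩ | ⟨j, k⟩ <;>
      simp only [Gen.isA, Creation.toGen, ne_eq, not_true_eq_false, Creation.aWeight,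
        Bool.not_false, Bool.not_true, if_true, Bool.false_eq_true, if_false] at h h1 ⊢ <;> omega

theorem annihilatePoly_mem_aFiltrationPoly {d : ℕ} {q : Polynomial (CDO N)}
    (hq : q ∈ aFiltrationPoly N d) (x : Gen N) :
    annihilatePoly x q ∈ aFiltrationPoly N (if !x.isA then d - 1 else d) :=
  sum_mem fun p _ => mul_X_pow_mem_aFiltrationPoly (annihilate_mem_aFiltrationPoly (hq p) x) p

theorem foldr_delGen_mem_aFiltration {d : ℕ} {u : CDO N} (hu : u ∈ aFiltration N d)
    (l : List (Gen N)) : l.foldr delGen u ∈ aFiltration N (d - l.countP Gen.isA) := by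
  induction l with
  | nil => exact hu
  | cons x l ih =>
    have h := delGen_mem_aFiltration ih x
    rw [List.foldr_cons, List.countP_cons]
    split_ifs at h ⊢ with hx
    · rwa [Nat.sub_sub] at h
    · rwa [add_zero]

theorem foldr_annihilatePoly_mem_aFiltrationPoly {d : ℕ} {q : Polynomial (CDO N)}
    (hq : q ∈ aFiltrationPoly N d) (l : List (Gen N)) :
    l.foldr annihilatePoly q ∈ aFiltrationPoly N (d - l.countP fun x => !x.isA) := by
  induction l with
  | nil => exact hq
  | cons x l ih =>
    have h := annihilatePoly_mem_aFiltrationPoly ih x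
    rw [List.foldr_cons, List.countP_cons]
    split_ifs at h ⊢ with hx
    · rwa [Nat.sub_sub] at h
    · rwa [add_zero]

/-- Each `aⁱ`-type factor of a Wick contraction consumes an `a` of `u`, and each `bⁱ`-type factor
consumes an `a` of `v`; long contractions therefore vanish. -/
theorem foldr_eq_zero_of_le {d e : ℕ} {u v : CDO N} (hu : u ∈ aFiltration N d)
    (hv : v ∈ aFiltration N e) {l : List (Gen N)} (hl : d + e ≤ l.length + 1) :
    l.foldr delGen u = 0 ∨ l.foldr annihilatePoly (Polynomial.C v) = 0 := by
  have h1 := foldr_delGen_mem_aFiltration hu l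
  have h2 := foldr_annihilatePoly_mem_aFiltrationPoly (C_mem_aFiltrationPoly hv) l
  have h3 : l.length = l.countP Gen.isA + l.countP fun x => !x.isA := by
    rw [List.length_eq_countP_add_countP Gen.isA]
    congr 2
    funext x
    simp
  by_cases h : d ≤ l.countP Gen.isA
  · left
    rw [Nat.sub_eq_zero_of_le h] at h1
    exact aFiltration_zero h1
  · right
    rw [Nat.sub_eq_zero_of_le (by omega)] at h2
    refine Polynomial.ext fun p => ?_
    rw [Polynomial.coeff_zero]
    exact aFiltration_zero (h2 p)

theorem exists_foldr_eq_zero (u v : CDO N) : ∃ K : ℕ, ∀ l : List (Gen N), K ≤ l.length →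
    l.foldr delGen u = 0 ∨ l.foldr annihilatePoly (Polynomial.C v) = 0 := by
  obtain ⟨d, hu⟩ := exists_mem_aFiltration u
  obtain ⟨e, hv⟩ := exists_mem_aFiltration v
  exact ⟨d + e, fun l hl => foldr_eq_zero_of_le hu hv (by omega)⟩

/-! ### The state-field correspondence -/

open TensorProduct

theorem dividedTranslation_zero (u : CDO N) : dividedTranslation 0 u = u := by
  simp [dividedTranslation]

theorem dividedTranslation_one (u : CDO N) : dividedTranslation 1 u = translation u := by
  simp [dividedTranslation]

theorem dividedTranslation_add (k : ℕ) (u v : CDO N) :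
    dividedTranslation k (u + v) = dividedTranslation k u + dividedTranslation k v := by
  simp only [dividedTranslation]
  rw [← smul_add]
  congr 1
  exact iterate_map_add translationₗ k u v

theorem dividedTranslation_smul (k : ℕ) (c : ℂ) (u : CDO N) :
    dividedTranslation k (c • u) = c • dividedTranslation k u := by
  simp only [dividedTranslation]
  rw [smul_comm]
  congr 1
  exact (Function.Commute.iterate_left (f := translation) (g := fun u : CDO N => c • u)
    (fun u => translation_smul c u) k) u

theorem dividedTranslation_translation (k : ℕ) (u : CDO N) :
    dividedTranslation k (translation u) = ((k : ℂ) + 1) • dividedTranslation (k + 1) u := by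
  have h : ((k : ℂ) + 1) ≠ 0 := by exact_mod_cast Nat.succ_ne_zero k
  rw [dividedTranslation, dividedTranslation, Function.iterate_succ_apply, smul_smul,
    Nat.factorial_succ]
  congr 1
  push_cast
  rw [mul_inv, mul_inv_cancel_left₀ h]

/-- The coefficient at `z⁻ⁿ⁻¹` in `(e^{zT} u) q(z⁻¹)`. -/
def modeCoeff (n : ℤ) (u : CDO N) (q : Polynomial (CDO N)) : CDO N :=
  q.sum fun p w => if n < p then dividedTranslation ((p : ℤ) - n - 1).toNat u * w else 0

theorem modeCoeff_monomial (n : ℤ) (u : CDO N) (p : ℕ) (w : CDO N) :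
    modeCoeff n u (Polynomial.monomial p w) =
      if n < p then dividedTranslation ((p : ℤ) - n - 1).toNat u * w else 0 := by
  rw [modeCoeff, Polynomial.sum_monomial_index]
  rw [mul_zero, ite_self]

theorem modeCoeff_add_right (n : ℤ) (u : CDO N) (q r : Polynomial (CDO N)) :
    modeCoeff n u (q + r) = modeCoeff n u q + modeCoeff n u r := by
  refine Polynomial.sum_add_index _ _ _ (fun p => ?_) fun p v w => ?_
  · rw [mul_zero, ite_self]
  · split_ifs
    · exact mul_add _ _ _
    · exact (add_zero 0).symm

theorem modeCoeff_smul_right (n : ℤ) (c : ℂ) (u : CDO N) (q : Polynomial (CDO N)) :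
    modeCoeff n u (c • q) = c • modeCoeff n u q := by
  rw [modeCoeff, Polynomial.sum_smul_index' _ _ _ fun _ => by rw [mul_zero, ite_self],
    modeCoeff, Polynomial.smul_sum]
  refine Finset.sum_congr rfl fun p _ => ?_
  simp only [smul_ite, smul_zero, mul_smul_comm]

theorem modeCoeff_add_left (n : ℤ) (u v : CDO N) (q : Polynomial (CDO N)) :
    modeCoeff n (u + v) q = modeCoeff n u q + modeCoeff n v q := by
  rw [modeCoeff, modeCoeff, modeCoeff, ← Polynomial.sum_add]
  refine Finset.sum_congr rfl fun p _ => ?_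
  dsimp only
  split_ifs
  · simp only [dividedTranslation_add, add_mul]
  · exact (add_zero 0).symm

theorem modeCoeff_smul_left (n : ℤ) (c : ℂ) (u : CDO N) (q : Polynomial (CDO N)) :
    modeCoeff n (c • u) q = c • modeCoeff n u q := by
  rw [modeCoeff, modeCoeff, Polynomial.smul_sum]
  refine Finset.sum_congr rfl fun p _ => ?_
  simp only [smul_ite, smul_zero, dividedTranslation_smul, smul_mul_assoc]

/-- `modeCoeff n` as a linear map on the tensor product. -/
def modeMap (N : ℕ) (n : ℤ) : CDO N ⊗[ℂ] Polynomial (CDO N) →ₗ[ℂ] CDO N :=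
  TensorProduct.lift (LinearMap.mk₂ ℂ (modeCoeff n) (modeCoeff_add_left n)
    (modeCoeff_smul_left n) (modeCoeff_add_right n) fun c u q => modeCoeff_smul_right n c u q)

theorem modeMap_tmul (n : ℤ) (u : CDO N) (q : Polynomial (CDO N)) :
    modeMap N n (u ⊗ₜ q) = modeCoeff n u q := rfl

/-- `d/dz` acts on `(e^{zT} u) q` by the product rule. -/
theorem modeCoeff_translation_add (n : ℤ) (u : CDO N) (q : Polynomial (CDO N)) :
    modeCoeff n (translation u) q + modeCoeff n u (derivZ q) =
      (-(n : ℂ)) • modeCoeff (n - 1) u q := by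
  induction q using Polynomial.induction_on' with
  | add q r hq hr =>
    rw [map_add, modeCoeff_add_right, modeCoeff_add_right, modeCoeff_add_right, smul_add, ← hq,
      ← hr]
    abel
  | monomial p w =>
    rw [derivZ_monomial, modeCoeff_smul_right, modeCoeff_monomial, modeCoeff_monomial,
      modeCoeff_monomial]
    rcases lt_trichotomy n p with h | h | h
    · obtain ⟨k, hk⟩ := Int.eq_ofNat_of_zero_le (show 0 ≤ (p : ℤ) - n - 1 by omega)
      have h1 : ((p : ℤ) - n - 1).toNat = k := by omega
      have h2 : (((p + 1 : ℕ) : ℤ) - n - 1).toNat = k + 1 := by omega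
      have h3 : ((p : ℤ) - (n - 1) - 1).toNat = k + 1 := by omega
      rw [if_pos h, if_pos (by omega), if_pos (by omega), h1, h2, h3,
        dividedTranslation_translation, smul_mul_assoc, ← add_smul]
      congr 1
      have : (n : ℂ) = p - k - 1 := by
        have h4 : n = p - k - 1 := by omega
        rw [h4]
        push_cast
        ring
      rw [this]
      ring
    · subst h
      rw [if_neg (lt_irrefl _), if_pos (by omega), if_pos (by omega), zero_add]
      have h2 : (((p + 1 : ℕ) : ℤ) - p - 1).toNat = 0 := by omega
      have h3 : ((p : ℤ) - (p - 1) - 1).toNat = 0 := by omega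
      rw [h2, h3]
      norm_cast
    · rw [if_neg (by omega), if_neg (by omega), if_neg (by omega), smul_zero, smul_zero, add_zero]

theorem finite_setOf_delGenₗ_ne_zero (u : CDO N) : {x : Gen N | delGenₗ x u ≠ 0}.Finite := by
  simpa only [delGenₗ_apply] using finite_setOf_delGen_ne_zero u

/-- The operator `∑ₓ ∂ₓ ⊗ x₋(z)`, whose exponential yields the state-field correspondence. -/
def fieldWickOp (N : ℕ) :
    CDO N ⊗[ℂ] Polynomial (CDO N) →ₗ[ℂ] CDO N ⊗[ℂ] Polynomial (CDO N) :=
  wickOp delGenₗ annihilatePolyₗ finite_setOf_delGenₗ_ne_zero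

theorem foldr_delGenₗ (l : List (Gen N)) (u : CDO N) :
    l.foldr (fun x w => delGenₗ x w) u = l.foldr delGen u := by
  simp only [delGenₗ_apply]

theorem foldr_annihilatePolyₗ (l : List (Gen N)) (q : Polynomial (CDO N)) :
    l.foldr (fun x w => annihilatePolyₗ x w) q = l.foldr annihilatePoly q := by
  simp only [annihilatePolyₗ_apply]

/-- `Y(u, z)v` is obtained from `exp (∑ₓ ∂ₓ ⊗ x₋(z)) (u ⊗ v)`. -/
theorem nthProd_eq_sum {u v : CDO N} {K : ℕ}
    (hK : ∀ l : List (Gen N), K ≤ l.length →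
      l.foldr delGen u = 0 ∨ l.foldr annihilatePoly (Polynomial.C v) = 0) (n : ℤ) :
    nthProd n u v = ∑ k ∈ Finset.range K,
      ((k.factorial : ℂ)⁻¹) • modeMap N n ((fieldWickOp N ^ k) (u ⊗ₜ Polynomial.C v)) := by
  have h := finsum_list_eq_sum_wickOp_pow (d := delGenₗ) (A := annihilatePolyₗ)
    (hd := finite_setOf_delGenₗ_ne_zero (N := N))
    (fun x y u => by simp only [delGenₗ_apply]; exact delGen_comm x y u) (modeMap N n)
    (u := u) (q := Polynomial.C v) (K := K)
    (fun l hl => by rw [foldr_delGenₗ, foldr_annihilatePolyₗ]; exact hK l hl)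
  refine Eq.trans ?_ h
  refine finsum_congr fun l => ?_
  rw [foldr_delGenₗ, foldr_annihilatePolyₗ, modeMap_tmul]
  rfl

theorem nthProd_add_left (n : ℤ) (u u' v : CDO N) :
    nthProd n (u + u') v = nthProd n u v + nthProd n u' v := by
  obtain ⟨K₁, h₁⟩ := exists_foldr_eq_zero u v
  obtain ⟨K₂, h₂⟩ := exists_foldr_eq_zero u' v
  obtain ⟨K₃, h₃⟩ := exists_foldr_eq_zero (u + u') v
  set K := max K₁ (max K₂ K₃)
  rw [nthProd_eq_sum (K := K) (fun l hl => h₁ l (by omega)),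
    nthProd_eq_sum (K := K) (fun l hl => h₂ l (by omega)),
    nthProd_eq_sum (K := K) (fun l hl => h₃ l (by omega)), ← Finset.sum_add_distrib]
  refine Finset.sum_congr rfl fun k _ => ?_
  rw [TensorProduct.add_tmul, map_add, map_add, smul_add]

theorem nthProd_smul_left (n : ℤ) (c : ℂ) (u v : CDO N) :
    nthProd n (c • u) v = c • nthProd n u v := by
  obtain ⟨K₁, h₁⟩ := exists_foldr_eq_zero u v
  obtain ⟨K₂, h₂⟩ := exists_foldr_eq_zero (c • u) v
  set K := max K₁ K₂
  rw [nthProd_eq_sum (K := K) (fun l hl => h₁ l (by omega)),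
    nthProd_eq_sum (K := K) (fun l hl => h₂ l (by omega)), Finset.smul_sum]
  refine Finset.sum_congr rfl fun k _ => ?_
  rw [← TensorProduct.smul_tmul', map_smul, map_smul, smul_comm]

theorem commute_fieldWickOp :
    Commute (fieldWickOp N)
      (translationₗ.rTensor (Polynomial (CDO N)) + derivZₗ.lTensor (CDO N)) :=
  wickOp_commute (succ := Gen.succ) Gen.succ_injective (w := Gen.weight)
    (fun x u => by simp only [delGenₗ_apply, translationₗ_apply]; exact delGen_succ_translation x u)
    (fun x hx u => by
      simp only [delGenₗ_apply, translationₗ_apply]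
      exact delGen_translation_of_notMem_range hx u)
    fun x q => derivZ_annihilatePoly x q

/-- `Y(Tu, z) = ∂_z Y(u, z)`. -/
theorem nthProd_translation (n : ℤ) (u v : CDO N) :
    nthProd n (translation u) v = (-(n : ℂ)) • nthProd (n - 1) u v := by
  obtain ⟨K₁, h₁⟩ := exists_foldr_eq_zero u v
  obtain ⟨K₂, h₂⟩ := exists_foldr_eq_zero (translation u) v
  set K := max K₁ K₂
  set Δ := translationₗ.rTensor (Polynomial (CDO N)) + derivZₗ.lTensor (CDO N) with hΔ
  have hmode (t : CDO N ⊗[ℂ] Polynomial (CDO N)) :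
      modeMap N n (Δ t) = (-(n : ℂ)) • modeMap N (n - 1) t := by
    induction t using TensorProduct.induction_on with
    | zero => simp
    | add s t hs ht => rw [map_add, map_add, hs, ht, map_add, smul_add]
    | tmul u q =>
      rw [hΔ, LinearMap.add_apply, LinearMap.rTensor_tmul, LinearMap.lTensor_tmul, map_add]
      exact modeCoeff_translation_add n u q
  have hstart : translation u ⊗ₜ[ℂ] Polynomial.C v = Δ (u ⊗ₜ Polynomial.C v) := by
    rw [hΔ, LinearMap.add_apply, LinearMap.rTensor_tmul, LinearMap.lTensor_tmul,
      show derivZₗ (Polynomial.C v) = 0 from derivZ_C v, TensorProduct.tmul_zero, add_zero]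
    rfl
  rw [nthProd_eq_sum (K := K) (fun l hl => h₁ l (by omega)),
    nthProd_eq_sum (K := K) (fun l hl => h₂ l (by omega)), Finset.smul_sum]
  refine Finset.sum_congr rfl fun k _ => ?_
  rw [hstart, ← Module.End.mul_apply, ((commute_fieldWickOp (N := N)).pow_left k).eq,
    Module.End.mul_apply, hmode, smul_comm]

theorem field_translation (u : CDO N) : field (translation u) = fieldDeriv (field u) := by
  funext n v
  exact nthProd_translation n u v

/-! ### Products of states of low degree -/

theorem X_b_mul_C_mem_aFiltration (k : Fin N) (n : ℕ) (f : ConvSeries N) :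
    MvPolynomial.X (Creation.b k n) * MvPolynomial.C f ∈ aFiltration N 1 := by
  rw [mul_comm, MvPolynomial.C_mul_X_eq_monomial]
  exact monomial_mem_aFiltration f (by simp [Finsupp.weight_single, Creation.aWeight])

theorem X_a_mul_C_mem_aFiltration (j : Fin N) (n : ℕ) (f : ConvSeries N) :
    MvPolynomial.X (Creation.a j n) * MvPolynomial.C f ∈ aFiltration N 2 := by
  rw [mul_comm, MvPolynomial.C_mul_X_eq_monomial]
  exact monomial_mem_aFiltration f (by simp [Finsupp.weight_single, Creation.aWeight])

theorem translation_C_mem_aFiltration (f : ConvSeries N) :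
    translation (MvPolynomial.C f) ∈ aFiltration N 1 := by
  rw [translation_C]
  exact sum_mem fun i _ => by
    rw [mul_comm]
    exact X_b_mul_C_mem_aFiltration i 0 _

theorem modeCoeff_neg_one_C (u v : CDO N) : modeCoeff (-1) u (Polynomial.C v) = u * v := by
  rw [← Polynomial.monomial_zero_left, modeCoeff_monomial, if_pos (by norm_num),
    show (((0 : ℕ) : ℤ) - -1 - 1).toNat = 0 by rfl, dividedTranslation_zero]

theorem nthProd_neg_one_of_aFree {u v : CDO N} (hu : u ∈ aFiltration N 1)
    (hv : v ∈ aFiltration N 1) : nthProd (-1) u v = u * v := by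
  rw [nthProd_eq_sum (K := 1) (fun l hl => foldr_eq_zero_of_le hu hv (by omega))]
  simp [modeMap_tmul, modeCoeff_neg_one_C]

/-- The Wick formula for the product of `aʲ₋₁ f(b₀)` with a state free of the `aⁱ₋ₙ`: only the
contractions of `aʲ` contribute. -/
theorem nthProd_X_a_mul_C (n : ℤ) (j : Fin N) (f : ConvSeries N) {v : CDO N}
    (hv : v ∈ aFiltration N 1) :
    nthProd n (MvPolynomial.X (Creation.a j 0) * MvPolynomial.C f) v =
      modeCoeff n (MvPolynomial.X (Creation.a j 0) * MvPolynomial.C f) (Polynomial.C v) +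
        modeCoeff n (MvPolynomial.C f) (annihilate (Gen.a j 0) v) := by
  classical
  rw [nthProd_eq_sum (K := 2)
    (fun l hl => foldr_eq_zero_of_le (X_a_mul_C_mem_aFiltration j 0 f) hv (by omega))]
  rw [Finset.sum_range_succ, Finset.sum_range_one]
  simp only [Nat.factorial, Nat.cast_one, inv_one, one_smul, pow_zero, pow_one, mul_one,
    Module.End.one_apply, modeMap_tmul]
  congr 1
  set u : CDO N := MvPolynomial.X (Creation.a j 0) * MvPolynomial.C f with hu
  set S := insert (Gen.a j 0) (finite_setOf_delGenₗ_ne_zero u).toFinset with hS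
  have hS' : ∀ x ∉ S, delGenₗ x u = 0 := by
    intro x hx
    by_contra h
    exact hx (Finset.mem_insert_of_mem (by simpa using h))
  rw [fieldWickOp, wickOp_tmul hS', map_sum, Finset.sum_eq_single_of_mem (Gen.a j 0)
    (Finset.mem_insert_self _ _)]
  · rw [delGenₗ_apply, annihilatePolyₗ_apply, annihilatePoly_C, modeMap_tmul, hu, delGen_mul,
      delGen_X, if_pos (by rfl), delGen_C_of_ne (by simp), mul_zero, zero_add, mul_one]
  · intro x _ hx
    rcases x with ⟨i, n⟩ | ⟨i, n⟩
    · have h0 : annihilatePolyₗ (Gen.b i n) (Polynomial.C v) = 0 := by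
        rw [annihilatePolyₗ_apply, annihilatePoly_C]
        refine Polynomial.ext fun p => ?_
        rw [Polynomial.coeff_zero]
        exact aFiltration_zero (annihilate_mem_aFiltrationPoly hv (Gen.b i n) p)
      rw [h0, TensorProduct.tmul_zero, map_zero]
    · have h0 : delGenₗ (Gen.a i n) u = 0 := by
        rw [delGenₗ_apply, hu, delGen_mul, delGen_X, if_neg (by exact hx), delGen_C_of_ne (by simp),
          mul_zero, mul_zero, add_zero]
      rw [h0, TensorProduct.zero_tmul, map_zero]

theorem annihilate_translation_C (j : Fin N) (g : ConvSeries N) :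
    annihilate (Gen.a j 0) (translation (MvPolynomial.C g)) =
      Polynomial.monomial 1 (translation (MvPolynomial.C (del j g))) +
        Polynomial.monomial 2 (MvPolynomial.C (del j g)) := by
  have h1 (i : Fin N) : delCoeff i (translation (MvPolynomial.C g)) =
      translation (MvPolynomial.C (del i g)) := by
    have := delGen_translation_of_notMem_range (x := Gen.b i 0)
      (by rintro ⟨y, hy⟩; cases y <;> simp [Gen.succ] at hy) (MvPolynomial.C g)
    rwa [delGen_b_zero_C] at this
  rw [annihilate]
  congr 1
  · simp only [h1]
    rw [Finset.sum_eq_single j]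
    · simp [contraction, Polynomial.C_mul_X_eq_monomial]
    · intro i _ hi
      simp [contraction, Ne.symm hi]
    · simp
  · rw [translation_C, map_sum, Finset.sum_eq_single j]
    · rw [← MvPolynomial.smul_eq_C_mul, Derivation.map_smul, MvPolynomial.mkDerivation_X]
      simp only [Creation.toGen, contraction, if_pos]
      rw [← Polynomial.C_mul_X_pow_eq_monomial, ← Polynomial.smul_eq_C_mul,
        ← MvPolynomial.algebraMap_eq, algebraMap_smul]
      simp
    · intro i _ hi
      rw [← MvPolynomial.smul_eq_C_mul, Derivation.map_smul, MvPolynomial.mkDerivation_X]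
      simp [Creation.toGen, contraction, Ne.symm hi]
    · simp

/-- The product `(aʲ₋₁ f(b₀))₍₋₁₎ T g(b₀)`. The last two terms come from the simple and the double
pole of the contraction of `aʲ` with `T g(b)`. -/
theorem nthProd_neg_one_X_a_mul_C (j : Fin N) (f g : ConvSeries N) :
    nthProd (-1) (MvPolynomial.X (Creation.a j 0) * MvPolynomial.C f)
        (translation (MvPolynomial.C g)) =
      MvPolynomial.X (Creation.a j 0) * MvPolynomial.C f * translation (MvPolynomial.C g) +
        (translation (MvPolynomial.C f) * translation (MvPolynomial.C (del j g)) +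
          (1 / 2 : ℂ) • (translation (translation (MvPolynomial.C f)) *
            MvPolynomial.C (del j g))) := by
  rw [nthProd_X_a_mul_C _ _ _ (translation_C_mem_aFiltration g), modeCoeff_neg_one_C,
    annihilate_translation_C, modeCoeff_add_right, modeCoeff_monomial, modeCoeff_monomial,
    if_pos (by norm_num), if_pos (by norm_num), show (((1 : ℕ) : ℤ) - -1 - 1).toNat = 1 by rfl,
    show (((2 : ℕ) : ℤ) - -1 - 1).toNat = 2 by rfl, dividedTranslation_one]
  simp [dividedTranslation]

theorem nthProd_sum_left {κ : Type*} (n : ℤ) (s : Finset κ) (f : κ → CDO N) (v : CDO N) :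
    nthProd n (∑ k ∈ s, f k) v = ∑ k ∈ s, nthProd n (f k) v := by
  have h0 : nthProd n 0 v = 0 := by simpa using nthProd_smul_left n 0 (0 : CDO N) v
  exact map_sum (⟨⟨fun u => nthProd n u v, h0⟩, fun u u' => nthProd_add_left n u u' v⟩ :
    CDO N →+ CDO N) f s

theorem del_coord (i j : Fin N) : del i (coord j) = if i = j then 1 else 0 := by
  refine Subtype.ext ?_
  change MvPowerSeries.pderiv ℂ i (MvPowerSeries.X j) = _
  rw [MvPowerSeries.pderiv_X]
  split_ifs <;> simp_all

theorem virasoro_eq : virasoro N =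
    ∑ i, MvPolynomial.X (Creation.a i 0) * MvPolynomial.X (Creation.b i 0) := by
  rw [virasoro, virasoroState]
  refine Finset.sum_congr rfl fun i _ => ?_
  have h := nthProd_neg_one_X_a_mul_C i 1 (coord i)
  rw [map_one, mul_one, translation_one, translation_zero, zero_mul, zero_mul, smul_zero, add_zero,
    add_zero, translation_C] at h
  rw [stateA, stateB, ofSeries, translation_C, h]
  congr 1
  rw [Finset.sum_eq_single i]
  · rw [del_coord, if_pos rfl, map_one, one_mul]
  · intro k _ hk
    rw [del_coord, if_neg hk, map_zero, zero_mul]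
  · simp

/-! ### Derivatives of the Jacobian matrix -/

theorem map_del_mul (r : Fin N) (A B : Matrix (Fin N) (Fin N) (ConvSeries N)) :
    (A * B).map (del r) = A * B.map (del r) + A.map (del r) * B := by
  refine Matrix.ext fun i j => ?_
  simp only [Matrix.map_apply, Matrix.mul_apply, Matrix.add_apply, map_sum, del_mul]
  rw [← Finset.sum_add_distrib]
  exact Finset.sum_congr rfl fun k _ => by rw [mul_comm (B k j)]

theorem map_del_one (r : Fin N) :
    (1 : Matrix (Fin N) (Fin N) (ConvSeries N)).map (del r) = 0 := by
  have h := map_del_mul r (1 : Matrix (Fin N) (Fin N) (ConvSeries N)) 1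
  rw [Matrix.one_mul, Matrix.one_mul, Matrix.mul_one] at h
  exact left_eq_add.1 h

theorem mul_map_del_inv {A : Matrix (Fin N) (Fin N) (ConvSeries N)} (hA : IsUnit A.det)
    (r : Fin N) : A * A⁻¹.map (del r) = -(A.map (del r) * A⁻¹) := by
  have h := map_del_mul r A A⁻¹
  rw [Matrix.mul_nonsing_inv A hA, map_del_one] at h
  exact eq_neg_of_add_eq_zero_left h.symm

theorem map_del_inv {A : Matrix (Fin N) (Fin N) (ConvSeries N)} (hA : IsUnit A.det)
    (r : Fin N) : A⁻¹.map (del r) = -(A⁻¹ * A.map (del r) * A⁻¹) := by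
  have h := congrArg (A⁻¹ * ·) (mul_map_del_inv hA r)
  simpa only [Matrix.nonsing_inv_mul_cancel_left _ _ hA, Matrix.mul_neg, Matrix.mul_assoc] using h

/-- `∂ᵣ log det A = tr (A⁻¹ ∂ᵣA)`. -/
theorem IsLog.del_eq_trace {lam : ConvSeries N} {A : Matrix (Fin N) (Fin N) (ConvSeries N)}
    (hA : IsUnit A.det) (h : IsLog lam A.det) (r : Fin N) :
    del r lam = (A⁻¹ * A.map (del r)).trace := by
  refine hA.mul_left_cancel ?_
  have h1 := leibniz_det (del r).toAddMonoidHom (fun a b => del_mul r a b) A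
  have h2 : A.adjugate = A.det • A⁻¹ := by
    rw [Matrix.inv_def, smul_smul, Ring.mul_inverse_cancel _ hA, one_smul]
  rw [h.mul_del r]
  refine h1.trans ?_
  rw [h2, Matrix.smul_mul, Matrix.trace_smul, smul_eq_mul]
  rfl

theorem sum_sum_comm_pairs {ι M : Type*} [Fintype ι] [AddCommMonoid M] (t : ι → ι → ι → ι → M) :
    ∑ i, ∑ j, ∑ k, ∑ l, t i j k l = ∑ k, ∑ l, ∑ i, ∑ j, t i j k l := by
  have h (i : ι) : ∑ j, ∑ k, ∑ l, t i j k l = ∑ k, ∑ l, ∑ j, t i j k l :=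
    Finset.sum_comm_cycle.symm
  simp only [h]
  exact Finset.sum_comm_cycle.symm

theorem sum_neg_mul_neg_eq_trace_mul {ι R : Type*} [Fintype ι] [CommRing R] (A B : Matrix ι ι R) :
    ∑ p, ∑ r, -A r p * -B p r = (A * B).trace := by
  rw [Finset.sum_comm]
  exact Finset.sum_congr rfl fun r _ => Finset.sum_congr rfl fun p _ => neg_mul_neg _ _

theorem del_jacobian_comm (g : Fin N → ConvSeries N) (i j k : Fin N) :
    del i (jacobian g j k) = del j (jacobian g i k) :=
  del_comm i j (g k)

theorem sum_jacobian_mul_del_phi {g : Fin N → ConvSeries N} (hg : IsUnit (jacobian g).det)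
    (k r p : Fin N) : ∑ l, jacobian g k l * del r (phi g p l) =
      -((jacobian g).map (del k) * (jacobian g)⁻¹) r p := by
  have h1 := congrFun (congrFun (mul_map_del_inv hg r) k) p
  rw [Matrix.mul_apply, Matrix.neg_apply] at h1
  refine Eq.trans h1 (congrArg Neg.neg ?_)
  rw [Matrix.mul_apply, Matrix.mul_apply]
  exact Finset.sum_congr rfl fun l _ => by
    rw [Matrix.map_apply, Matrix.map_apply, del_jacobian_comm]

theorem sum_hMatrix_mul_jacobian_eq {g : Fin N → ConvSeries N} (hg : IsUnit (jacobian g).det)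
    (k m : Fin N) : ∑ i, hMatrix g k i * jacobian g m i = (1 / 2 : ℂ) •
      ∑ p, ∑ r, (∑ l, jacobian g k l * del r (phi g p l)) *
        ∑ i, jacobian g m i * del p (phi g r i) := by
  have hinv : (phi g).transpose⁻¹ = jacobian g := by
    rw [phi, Matrix.transpose_transpose, Matrix.nonsing_inv_nonsing_inv _ hg]
  have h2 (p r : Fin N) : (∑ l, jacobian g k l * del r (phi g p l)) *
        ∑ i, jacobian g m i * del p (phi g r i) =
      ∑ i, ∑ l, jacobian g k l * (del r (phi g p l) * del p (phi g r i)) * jacobian g m i := by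
    rw [mul_comm, Finset.sum_mul_sum]
    refine Finset.sum_congr rfl fun i _ => Finset.sum_congr rfl fun l _ => ?_
    ring
  have h3 (i : Fin N) : hMatrix g k i * jacobian g m i = (1 / 2 : ℂ) •
      ∑ l, ∑ p, ∑ r, jacobian g k l * (del r (phi g p l) * del p (phi g r i)) *
        jacobian g m i := by
    rw [hMatrix, hinv, Matrix.smul_apply, smul_mul_assoc, Matrix.mul_apply, Finset.sum_mul]
    simp only [psi, Matrix.of_apply, Finset.mul_sum, Finset.sum_mul]
  simp only [h2, h3]
  rw [← Finset.smul_sum, sum_sum_comm_pairs]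

/-- The quadratic term in `b'` of the transformed Virasoro field. Differentiating
`∂g (∂g)⁻¹ = 1` and using `∂ᵢ∂ⱼg = ∂ⱼ∂ᵢg` turns `ψ` into a trace. -/
theorem sum_hMatrix_mul_jacobian {g : Fin N → ConvSeries N} (hg : IsUnit (jacobian g).det)
    (k m : Fin N) : ∑ i, hMatrix g k i * jacobian g m i =
      (-(1 / 2) : ℂ) • ∑ i, ∑ j, del k (phi g j i) * del m (jacobian g j i) := by
  have h2 : ∑ i, ∑ j, del k (phi g j i) * del m (jacobian g j i) =
      -((jacobian g).map (del k) * (jacobian g)⁻¹ *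
        ((jacobian g).map (del m) * (jacobian g)⁻¹)).trace := by
    have h3 : ∑ i, ∑ j, del k (phi g j i) * del m (jacobian g j i) =
        ((jacobian g)⁻¹.map (del k) * (jacobian g).map (del m)).trace := rfl
    rw [h3, map_del_inv hg, Matrix.neg_mul, Matrix.trace_neg, Matrix.mul_assoc, Matrix.mul_assoc,
      Matrix.trace_mul_comm]
    simp only [Matrix.mul_assoc]
  rw [sum_hMatrix_mul_jacobian_eq hg, h2, neg_smul, smul_neg, neg_neg,
    ← sum_neg_mul_neg_eq_trace_mul]
  simp only [sum_jacobian_mul_del_phi hg]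

/-! ### The transformed Virasoro vector -/

theorem sum_phi_mul_jacobian {g : Fin N → ConvSeries N} (hg : IsUnit (jacobian g).det)
    (j m : Fin N) : ∑ i, phi g j i * jacobian g m i = if j = m then 1 else 0 := by
  have h := congrFun (congrFun (Matrix.mul_nonsing_inv _ hg) m) j
  rw [Matrix.mul_apply, Matrix.one_apply] at h
  simp only [eq_comm (a := j)]
  rw [← h]
  exact Finset.sum_congr rfl fun i _ => mul_comm _ _

theorem virasoroState_trans (g : Fin N → ConvSeries N) :
    virasoroState (transA g (hMatrix g)) (transB g) =
      ∑ i, (∑ j, (MvPolynomial.X (Creation.a j 0) * MvPolynomial.C (phi g j i) *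
            translation (MvPolynomial.C (g i)) +
          (translation (MvPolynomial.C (phi g j i)) * translation (MvPolynomial.C (jacobian g j i)) +
            (1 / 2 : ℂ) • (translation (translation (MvPolynomial.C (phi g j i))) *
              MvPolynomial.C (jacobian g j i)))) +
        ∑ k, MvPolynomial.X (Creation.b k 0) * MvPolynomial.C (hMatrix g k i) *
          translation (MvPolynomial.C (g i))) := by
  rw [virasoroState]
  refine Finset.sum_congr rfl fun i _ => ?_
  rw [transA, nthProd_add_left, nthProd_sum_left, nthProd_sum_left]
  refine congrArg₂ (· + ·) (Finset.sum_congr rfl fun j _ => ?_) (Finset.sum_congr rfl fun k _ => ?_)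
  · exact nthProd_neg_one_X_a_mul_C j _ _
  · exact nthProd_neg_one_of_aFree (X_b_mul_C_mem_aFiltration k 0 _)
      (translation_C_mem_aFiltration _)

theorem translation_C_eq_sum_jacobian (g : Fin N → ConvSeries N) (i : Fin N) :
    translation (MvPolynomial.C (g i) : CDO N) =
      ∑ m, MvPolynomial.C (jacobian g m i) * MvPolynomial.X (Creation.b m 0) :=
  translation_C (g i)

theorem sum_X_a_mul_phi {g : Fin N → ConvSeries N} (hg : IsUnit (jacobian g).det) :
    ∑ i, ∑ j, MvPolynomial.X (Creation.a j 0) * MvPolynomial.C (phi g j i) *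
      translation (MvPolynomial.C (g i)) = virasoro N := by
  rw [virasoro_eq, Finset.sum_comm]
  refine Finset.sum_congr rfl fun j _ => ?_
  have h : ∑ i, MvPolynomial.C (phi g j i) * translation (MvPolynomial.C (g i)) =
      (MvPolynomial.X (Creation.b j 0) : CDO N) := by
    simp only [translation_C_eq_sum_jacobian, Finset.mul_sum, ← mul_assoc, ← map_mul]
    rw [Finset.sum_comm]
    simp only [← Finset.sum_mul, ← map_sum, sum_phi_mul_jacobian hg]
    rw [Finset.sum_eq_single j]
    · rw [if_pos rfl, map_one, one_mul]
    · intro m _ hm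
      rw [if_neg (Ne.symm hm), map_zero, zero_mul]
    · simp
  simp only [mul_assoc]
  rw [← Finset.mul_sum, h]

theorem sum_X_b_mul_hMatrix {g : Fin N → ConvSeries N} (hg : IsUnit (jacobian g).det) :
    ∑ i, ∑ k, MvPolynomial.X (Creation.b k 0) * MvPolynomial.C (hMatrix g k i) *
        translation (MvPolynomial.C (g i)) +
      (1 / 2 : ℂ) • ∑ i, ∑ j, translation (MvPolynomial.C (phi g j i)) *
        translation (MvPolynomial.C (jacobian g j i)) = (0 : CDO N) := by
  have h1 : ∑ i, ∑ k, MvPolynomial.X (Creation.b k 0) * MvPolynomial.C (hMatrix g k i) *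
        translation (MvPolynomial.C (g i)) =
      ∑ k, ∑ m, (MvPolynomial.X (Creation.b k 0) * MvPolynomial.X (Creation.b m 0)) *
        (MvPolynomial.C (∑ i, hMatrix g k i * jacobian g m i) : CDO N) := by
    simp only [translation_C_eq_sum_jacobian, Finset.mul_sum, map_sum, map_mul]
    rw [Finset.sum_comm]
    refine Finset.sum_congr rfl fun k _ => ?_
    rw [Finset.sum_comm]
    refine Finset.sum_congr rfl fun m _ => Finset.sum_congr rfl fun i _ => ?_
    ring
  have h2 : ∑ i, ∑ j, translation (MvPolynomial.C (phi g j i)) *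
        translation (MvPolynomial.C (jacobian g j i)) =
      ∑ k, ∑ m, (MvPolynomial.X (Creation.b k 0) * MvPolynomial.X (Creation.b m 0)) *
        (MvPolynomial.C (∑ i, ∑ j, del k (phi g j i) * del m (jacobian g j i)) : CDO N) := by
    have h (i j : Fin N) : translation (MvPolynomial.C (phi g j i)) *
        translation (MvPolynomial.C (jacobian g j i)) =
        ∑ k, ∑ m, (MvPolynomial.X (Creation.b k 0) * MvPolynomial.X (Creation.b m 0)) *
          (MvPolynomial.C (del k (phi g j i) * del m (jacobian g j i)) : CDO N) := by
      rw [translation_C, translation_C, Finset.sum_mul_sum]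
      refine Finset.sum_congr rfl fun k _ => Finset.sum_congr rfl fun m _ => ?_
      rw [map_mul]
      ring
    simp only [h, map_sum, Finset.mul_sum]
    exact sum_sum_comm_pairs _
  rw [h1, h2, Finset.smul_sum, ← Finset.sum_add_distrib]
  refine Finset.sum_eq_zero fun k _ => ?_
  rw [Finset.smul_sum, ← Finset.sum_add_distrib]
  refine Finset.sum_eq_zero fun m _ => ?_
  rw [sum_hMatrix_mul_jacobian hg, ← mul_smul_comm, ← mul_add]
  have hC (c : ℂ) (f : ConvSeries N) : (c • MvPolynomial.C f : CDO N) = MvPolynomial.C (c • f) := by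
    rw [MvPolynomial.C_apply, MvPolynomial.C_apply, MvPolynomial.smul_monomial]
  rw [hC, ← map_add, ← add_smul, neg_add_cancel, zero_smul, map_zero, mul_zero]

/-- `T² tr ((∂g)⁻¹ ∂g) = 0`, expanded by the product rule. -/
theorem translation_translation_sum_phi_mul_jacobian {g : Fin N → ConvSeries N}
    (hg : IsUnit (jacobian g).det) :
    ∑ i, ∑ j, translation (translation (MvPolynomial.C (phi g j i))) *
        MvPolynomial.C (jacobian g j i) +
      ((2 : ℂ) • ∑ i, ∑ j, translation (MvPolynomial.C (phi g j i)) *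
        translation (MvPolynomial.C (jacobian g j i)) +
      ∑ i, ∑ j, MvPolynomial.C (phi g j i) *
        translation (translation (MvPolynomial.C (jacobian g j i)))) = (0 : CDO N) := by
  have h1 : translation (translation
      (∑ i, ∑ j, MvPolynomial.C (phi g j i) * MvPolynomial.C (jacobian g j i))) = (0 : CDO N) := by
    rw [Finset.sum_comm]
    simp only [← map_mul, ← map_sum, sum_phi_mul_jacobian hg, if_true, map_one]
    simp only [translation_sum, translation_one, Finset.sum_const_zero, translation_zero]
  rw [← h1]
  simp only [translation_sum, Finset.smul_sum, ← Finset.sum_add_distrib]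
  refine Finset.sum_congr rfl fun i _ => Finset.sum_congr rfl fun j _ => ?_
  rw [translation_mul, translation_add, translation_mul, translation_mul, two_smul]
  ring

theorem translation_C_log {lam : ConvSeries N} {g : Fin N → ConvSeries N}
    (hg : IsUnit (jacobian g).det) (h : IsLog lam (jacobian g).det) :
    translation (MvPolynomial.C lam : CDO N) =
      ∑ i, ∑ j, MvPolynomial.C (phi g j i) * translation (MvPolynomial.C (jacobian g j i)) := by
  have hdel (r : Fin N) : del r lam = ∑ i, ∑ j, phi g j i * del r (jacobian g j i) :=
    h.del_eq_trace hg r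
  simp only [translation_C, hdel, map_sum, map_mul, Finset.sum_mul, Finset.mul_sum, mul_assoc]
  rw [← Finset.sum_comm_cycle]

/-- The transformation of the Virasoro vector. -/
theorem virasoroState_trans_add {lam : ConvSeries N} {g : Fin N → ConvSeries N}
    (hg : IsUnit (jacobian g).det) (h : IsLog lam (jacobian g).det) :
    virasoroState (transA g (hMatrix g)) (transB g) +
      (1 / 2 : ℂ) • translation (translation (ofSeries lam)) = virasoro N := by
  have hlog : translation (translation (ofSeries lam)) =
      ∑ i, ∑ j, translation (MvPolynomial.C (phi g j i)) *
        translation (MvPolynomial.C (jacobian g j i)) +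
      ∑ i, ∑ j, MvPolynomial.C (phi g j i) *
        translation (translation (MvPolynomial.C (jacobian g j i))) := by
    rw [ofSeries, translation_C_log hg h]
    simp only [translation_sum, ← Finset.sum_add_distrib]
    refine Finset.sum_congr rfl fun i _ => Finset.sum_congr rfl fun j _ => ?_
    rw [translation_mul]
    ring
  have hstate := virasoroState_trans g
  simp only [Finset.sum_add_distrib, ← Finset.smul_sum] at hstate
  rw [sum_X_a_mul_phi hg] at hstate
  have key {M : Type} [AddCommMonoid M] [Module ℂ M] {V B C D H : M}
      (hH : H + (1 / 2 : ℂ) • B = 0) (hC : C + ((2 : ℂ) • B + D) = 0) :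
      V + (B + (1 / 2 : ℂ) • C) + H + (1 / 2 : ℂ) • (B + D) = V := by
    calc V + (B + (1 / 2 : ℂ) • C) + H + (1 / 2 : ℂ) • (B + D)
        = V + (H + (1 / 2 : ℂ) • B) + (1 / 2 : ℂ) • (C + ((2 : ℂ) • B + D)) := by module
      _ = V := by rw [hH, hC, smul_zero, add_zero, add_zero]
  rw [hstate, hlog]
  exact key (sum_X_b_mul_hMatrix hg) (translation_translation_sum_phi_mul_jacobian hg)

theorem nthProd_neg_two_one (u : CDO N) : nthProd (-2) u 1 = translation u := by
  have hann (x : Gen N) : annihilate x (1 : CDO N) = 0 := by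
    have h0 (i : Fin N) : delCoeff i (1 : CDO N) = 0 := delGen_one (Gen.b i 0)
    simp only [annihilate, h0, map_zero, zero_mul, Finset.sum_const_zero, zero_add]
    exact Derivation.map_one_eq_zero _
  have hK : ∀ l : List (Gen N), 1 ≤ l.length →
      l.foldr delGen u = 0 ∨ l.foldr annihilatePoly (Polynomial.C 1) = 0 := by
    intro l hl
    right
    have hne : l ≠ [] := by rintro rfl; simp at hl
    obtain ⟨l', x, rfl⟩ := List.eq_nil_or_concat l |>.resolve_left hne
    -- the innermost annihilation operator already kills the vacuum
    rw [List.concat_eq_append, List.foldr_append, List.foldr_cons, List.foldr_nil,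
      annihilatePoly_C, hann]
    exact (foldr_annihilatePolyₗ l' 0).symm.trans (foldr_apply_zero annihilatePolyₗ l')
  rw [nthProd_eq_sum hK, Finset.sum_range_one, pow_zero, Module.End.one_apply, modeMap_tmul,
    ← Polynomial.monomial_zero_left, modeCoeff_monomial, if_pos (by norm_num),
    show (((0 : ℕ) : ℤ) - -2 - 1).toNat = 1 by rfl, dividedTranslation_one]
  simp

theorem IsAutomorphism.map_translation {F : CDO N ≃ₗ[ℂ] CDO N} (hF : IsAutomorphism F)
    (u : CDO N) : F (translation u) = translation (F u) := by
  rw [← nthProd_neg_two_one, hF.map_nthProd, hF.map_vacuum, nthProd_neg_two_one]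

theorem IsAutomorphism.map_virasoro {F : CDO N ≃ₗ[ℂ] CDO N} (hF : IsAutomorphism F)
    {α β : Fin N → CDO N} (hb : ∀ i, F (stateB i) = β i) (ha : ∀ i, F (stateA i) = α i) :
    F (virasoro N) = virasoroState α β := by
  rw [virasoro, virasoroState, virasoroState, map_sum]
  refine Finset.sum_congr rfl fun i _ => ?_
  rw [hF.map_nthProd, hF.map_translation, ha, hb]

theorem field_virasoroState_trans {lam : ConvSeries N} {g : Fin N → ConvSeries N}
    (hg : IsUnit (jacobian g).det) (h : IsLog lam (jacobian g).det) (n : ℤ) (v : CDO N) :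
    field (virasoroState (transA g (hMatrix g)) (transB g)) n v =
      field (virasoro N) n v -
        (1 / 2 : ℂ) • fieldDeriv (fieldDeriv (field (ofSeries lam))) n v := by
  rw [← field_translation, ← field_translation]
  refine eq_sub_of_add_eq ?_
  rw [← virasoroState_trans_add hg h]
  exact ((nthProd_add_left n _ _ v).trans
    (congrArg (_ + ·) (nthProd_smul_left n _ _ v))).symm

end

end ChiralDiffOp

open ChiralDiffOp in
theorem theorem9p1 {N : ℕ} (g : Fin N → ConvSeries N) (hg : IsUnit (jacobian g).det) :
    (∃ lam : ConvSeries N, IsLog lam (jacobian g).det) ∧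
    (∀ ℓ : Matrix (Fin N) (Fin N) (ConvSeries N),
      IsMatrixLog ℓ (jacobian g) → IsLog ℓ.trace (jacobian g).det) ∧
    ∀ lam : ConvSeries N, IsLog lam (jacobian g).det →
      (∀ (n : ℤ) (v : CDO N),
        field (virasoroState (transA g (hMatrix g)) (transB g)) n v =
          field (virasoro N) n v -
            (1 / 2 : ℂ) • fieldDeriv (fieldDeriv (field (ofSeries lam))) n v) ∧
      ∀ F : CDO N ≃ₗ[ℂ] CDO N, IsAutomorphism F →
        (∀ i, F (stateB i) = transB g i) →
        (∀ i, F (stateA i) = transA g (hMatrix g) i) →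
        ∀ (n : ℤ) (v : CDO N),
          field (F (virasoro N)) n v =
            field (virasoro N) n v -
              (1 / 2 : ℂ) • fieldDeriv (fieldDeriv (field (ofSeries lam))) n v := by
  refine ⟨exists_isLog hg, fun ℓ hℓ => hℓ.isLog_trace, fun lam hlam =>
    ⟨field_virasoroState_trans hg hlam, fun F hF hb ha n v => ?_⟩⟩
  rw [hF.map_virasoro hb ha]
  exact field_virasoroState_trans hg hlam n v
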